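/- Let $\ell\ge 7$ be an odd integer and let $K_{4\ell+1}$ be the complete graph on the vertex set $(\mathbb Z_{2\ell}\times\{0,1\})\cup\{\infty\}$; write $a_i$ for $(a,i)$. An $\ell$-cycle decomposition of a graph is a set of $\ell$-cycle subgraphs whose edge sets partition the edge set of the graph. A $2$-colouring of the vertices is equitable on such a decomposition if every cycle of it has $\lfloor \ell/2\rfloor$ or $\lceil \ell/2\rceil$ vertices of each colour. The decomposition is $2$-rotational if it is preserved by a permutation of the $4\ell+1$ vertices which consists of exactly one fixed point and two cycles of length $2\ell$. Colour $a_0$ red for $0\le a\le \ell-1$ and blue for $\ell\le a\le 2\ell-1$, colour $a_1$ blue for $0\le a\le \ell-1$ and red for $\ell\le a\le 2\ell-1$, and colour $\infty$ blue. This colouring has $2\ell$ red and $2\ell+1$ blue vertices. Then there is a $2$-rotational $\ell$-cycle decomposition $\mathcal C$ of $K_{4\ell+1}$ on which this colouring is equitable; in particular $K_{4\ell+1}$ has an equitably $2$-colourable $\ell$-cycle decomposition with colour classes of sizes $2\ell$ and $2\ell+1$. Moreover $\mathcal C$ can be chosen to be the set of all translates, under the maps $a_i\mapsto (a+t)_i$,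 $\infty\mapsto\infty$ ($t\in\mathbb Z_{2\ell}$), of six base cycles $C_0, C_1, C_p, C_\infty^0, C_\infty^1, C_2^0$ having exactly $2\ell, 2\ell, 2\ell, \ell, \ell, 2$ distinct translates respectively, where $C_\infty^0$ and $C_\infty^1$ contain the vertex $\infty$ and the other four base cycles do not. -/

import Mathlib

namespace EquitableCycles

/-- A set `𝒞` of subgraphs of `G` is an `ℓ`-cycle decomposition of `G` (intended for `ℓ ≥ 3`):
every member is isomorphic to the cycle graph on `ℓ` vertices, and the edge sets of the members
partition the edge set of `G`. -/
structure IsCycleDecomposition {V : Type*} (G : SimpleGraph V) (ℓ : ℕ)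
    (𝒞 : Set G.Subgraph) : Prop where
  isCycle : ∀ C ∈ 𝒞, Nonempty (C.coe ≃g SimpleGraph.cycleGraph ℓ)
  partition : ∀ e ∈ G.edgeSet, ∃! C, C ∈ 𝒞 ∧ e ∈ C.edgeSet

/-- A vertex colouring `φ` with finite colour set `S` is equitable on the `ℓ`-cycle decomposition
`𝒞` if every cycle has `⌊ℓ / |S|⌋` or `⌈ℓ / |S|⌉` vertices of each colour. -/
def IsEquitableColouring {V S : Type*} [Fintype S] {G : SimpleGraph V} (ℓ : ℕ)
    (𝒞 : Set G.Subgraph) (φ : V → S) : Prop :=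
  ∀ C ∈ 𝒞, ∀ s : S,
    {v | v ∈ C.verts ∧ φ v = s}.ncard = ℓ / Fintype.card S ∨
    {v | v ∈ C.verts ∧ φ v = s}.ncard = ℓ ⌈/⌉ Fintype.card S

/-- `𝒞` is `2`-rotational with cycle length `n`: some automorphism `σ` of `G` carries `𝒞` onto
itself and, as a permutation of the vertices, consists of exactly one fixed point `p` and
exactly two cycles (those of `x` and `y`), each of length `n`. -/
def IsTwoRotational {V : Type*} {G : SimpleGraph V} (n : ℕ) (𝒞 : Set G.Subgraph) : Prop :=
  ∃ σ : G ≃g G,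
    (fun C : G.Subgraph => C.map σ.toHom) '' 𝒞 = 𝒞 ∧
    ∃ p x y : V,
      (∀ v, σ v = v ↔ v = p) ∧
      0 < n ∧ Function.minimalPeriod σ x = n ∧ Function.minimalPeriod σ y = n ∧
      ¬ Equiv.Perm.SameCycle σ.toEquiv x y ∧
      ∀ v, v = p ∨ Equiv.Perm.SameCycle σ.toEquiv x v ∨ Equiv.Perm.SameCycle σ.toEquiv y v

/-- The vertex set `(ℤ/n × {0, 1}) ∪ {∞}`, with `∞` being `none`. -/
abbrev Vertex (n : ℕ) : Type := Option (ZMod n × Fin 2)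

/-- The vertex set has `2n + 1` elements. -/
theorem card_vertex (n : ℕ) (hn : n ≠ 0) : Nat.card (Vertex n) = 2 * n + 1 := by
  have : NeZero n := ⟨hn⟩
  simp [Nat.card_eq_fintype_card, ZMod.card, mul_comm]

/-- Translation by `t` in the first coordinate, fixing `∞`. -/
def translate {n : ℕ} (t : ZMod n) : Equiv.Perm (Vertex n) :=
  Equiv.optionCongr ((Equiv.addRight t).prodCongr (Equiv.refl (Fin 2)))

/-- The translate `C + t` of a subgraph `C` of the complete graph. -/
def translateSubgraph {n : ℕ} (t : ZMod n) (C : (SimpleGraph.completeGraph (Vertex n)).Subgraph) :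
    (SimpleGraph.completeGraph (Vertex n)).Subgraph :=
  C.map (SimpleGraph.Iso.completeGraph (translate t)).toHom

/-- The set of all translates of `C`: the development of `C` modulo `(n, -)`. -/
def development {n : ℕ} (C : (SimpleGraph.completeGraph (Vertex n)).Subgraph) :
    Set (SimpleGraph.completeGraph (Vertex n)).Subgraph :=
  Set.range fun t : ZMod n => translateSubgraph t C

/-- The two colours. -/
inductive Colour where
  | red
  | blue
  deriving DecidableEq

instance : Fintype Colour where
  elems := {Colour.red, Colour.blue}
  complete c := by cases c <;> simp

/-- The colouring: in part `0` the vertices `0, …, ℓ - 1` are red and `ℓ, …, 2ℓ - 1` are blue;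
in part `1` the colours are reversed; `∞` is blue. -/
def colouring (ℓ : ℕ) : Vertex (2 * ℓ) → Colour
  | none => Colour.blue
  | some (a, i) => if (a.val < ℓ ↔ i = 0) then Colour.red else Colour.blue

end EquitableCycles

/-!
The decomposition consists of the translates of six explicit base cycles, and everything reduces
to the differences that occur along their edges.

*Counting.* By construction three base cycles have at most `2ℓ` translates, the two cycles through
`∞` at most `ℓ`, and the last one at most `2`; together these are `8ℓ + 2` cycles with at most
`ℓ (8ℓ + 2)` edges, which is the number of edges of the complete graph. Hence as soon as the
translates cover all edges, no edge is covered twice and the numbers of translates are exact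
(`isCycleDecomposition_of_cover`). An edge not at `∞` is covered if and only if its difference
occurs in a base cycle, so only the presence of each difference has to be checked
(`covers_of_hasDiff`), never its uniqueness.

*Colouring.* The colouring is changed at every vertex other than `∞` both by the exchange
`a_0 ↔ a_1` of the parts and by the antipodal map `a_i ↦ (a + ℓ)_i`, and both maps commute with
translations. So every translate of a cycle is equitably coloured if one of these maps pairs off
all its vertices but one (`isEquitableColouring_development`). Three base cycles are made of such
pairs `a_0, a_1` and one more vertex. The cycles through `∞` are
`∞, x_0, …, x_{k-1}, x_{k-1} + ℓ, …, x_0 + ℓ` with `ℓ = 2k + 1`; their antipodal symmetry halves the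
number of translates. The last cycle `0, 2ε, 4ε, …` runs through the even elements of part `0`,
with `ε` invertible modulo `ℓ`; its translates have the vertex sets of all even and all odd
elements, which are equitably coloured by inspection.

*Construction.* The base cycles are built from zigzags, whose consecutive differences are
consecutive integers. A zigzag within one part yields pure differences, one that alternates between
the parts yields mixed ones, and adding `ℓ` to suitable coordinates replaces differences `d` by
`ℓ + d`. The coordinates depend on `ℓ` modulo `4` (`isBaseSystem_even`, `isBaseSystem_odd`).
-/

namespace EquitableCycles

open SimpleGraph Finset

/-! ### Cycles given by vertex sequences -/

section Cycles

variable {V : Type*}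

/-- The closed walk `v 0, v 1, …, v (ℓ - 1), v 0` as a subgraph of the complete graph; it is an
`ℓ`-cycle as soon as `v` is injective on `{0, …, ℓ - 1}`. -/
def cycleSubgraph (ℓ : ℕ) (v : ℕ → V) : (completeGraph V).Subgraph where
  verts := v '' Set.Iio ℓ
  Adj a b := a ≠ b ∧ ∃ i < ℓ, (a = v i ∧ b = v ((i + 1) % ℓ)) ∨ (b = v i ∧ a = v ((i + 1) % ℓ))
  adj_sub h := h.1
  edge_vert := by
    rintro a b ⟨-, i, hi, ⟨rfl, -⟩ | ⟨-, rfl⟩⟩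
    · exact ⟨i, hi, rfl⟩
    · exact ⟨_, Nat.mod_lt _ (by omega), rfl⟩
  symm.symm := by
    rintro a b ⟨hab, i, hi, h⟩
    exact ⟨hab.symm, i, hi, h.symm⟩

theorem cycleSubgraph_adj {ℓ : ℕ} {v : ℕ → V} {a b : V} :
    (cycleSubgraph ℓ v).Adj a b ↔ a ≠ b ∧ ∃ i < ℓ,
      (a = v i ∧ b = v ((i + 1) % ℓ)) ∨ (b = v i ∧ a = v ((i + 1) % ℓ)) := Iff.rfl

theorem cycleSubgraph_verts {ℓ : ℕ} {v : ℕ → V} :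
    (cycleSubgraph ℓ v).verts = v '' Set.Iio ℓ := rfl

theorem succ_mod_eq {ℓ i : ℕ} (hi : i < ℓ) :
    (i + 1) % ℓ = if i + 1 = ℓ then 0 else i + 1 := by
  split_ifs with h
  · rw [h, Nat.mod_self]
  · exact Nat.mod_eq_of_lt (by omega)

theorem cycleSubgraph_adj_succ {ℓ : ℕ} {v : ℕ → V} (hv : Set.InjOn v (Set.Iio ℓ)) {i : ℕ}
    (hi : i + 1 < ℓ) : (cycleSubgraph ℓ v).Adj (v i) (v (i + 1)) := by
  refine ⟨fun h => ?_, i, by omega, Or.inl ⟨rfl, by rw [Nat.mod_eq_of_lt hi]⟩⟩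
  have := hv (Set.mem_Iio.2 (by omega)) (Set.mem_Iio.2 hi) h
  omega

theorem cycleSubgraph_adj_last {ℓ : ℕ} (hℓ : 2 ≤ ℓ) {v : ℕ → V}
    (hv : Set.InjOn v (Set.Iio ℓ)) : (cycleSubgraph ℓ v).Adj (v (ℓ - 1)) (v 0) := by
  refine ⟨fun h => ?_, ℓ - 1, by omega, Or.inl ⟨rfl, ?_⟩⟩
  · have := hv (Set.mem_Iio.2 (by omega)) (Set.mem_Iio.2 (by omega)) h
    omega
  · rw [show ℓ - 1 + 1 = ℓ by omega, Nat.mod_self]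

theorem cycleSubgraph_iso {ℓ : ℕ} (hℓ : 3 ≤ ℓ) {v : ℕ → V} (hv : Set.InjOn v (Set.Iio ℓ)) :
    Nonempty ((cycleSubgraph ℓ v).coe ≃g cycleGraph ℓ) := by
  have hinj : Function.Injective fun i : Fin ℓ => v i := fun i j h =>
    Fin.ext (hv i.2 j.2 h)
  have hrange : Set.range (fun i : Fin ℓ => v i) = (cycleSubgraph ℓ v).verts := by
    ext x
    constructor
    · rintro ⟨i, rfl⟩
      exact ⟨i, i.2, rfl⟩
    · rintro ⟨i, hi, rfl⟩
      exact ⟨⟨i, hi⟩, rfl⟩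
  refine ⟨RelIso.symm ⟨(Equiv.ofInjective _ hinj).trans (Equiv.setCongr hrange), ?_⟩⟩
  intro i j
  obtain ⟨m, rfl⟩ : ∃ m, ℓ = m + 2 := ⟨ℓ - 2, by omega⟩
  rw [cycleGraph_adj', Subgraph.coe_adj, cycleSubgraph_adj]
  simp only [Equiv.trans_apply, Equiv.setCongr_apply, Equiv.ofInjective_apply]
  have hval : ∀ a b : Fin (m + 2), (a - b).val = 1 ↔ a.val = (b.val + 1) % (m + 2) := by
    intro a b
    have ha := a.2
    have hb := b.2
    rw [Fin.val_sub, succ_mod_eq b.2]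
    rcases le_or_gt b.val a.val with h | h
    · rw [show m + 2 - b.val + a.val = a.val - b.val + (m + 2) by omega, Nat.add_mod_right,
        Nat.mod_eq_of_lt (by omega)]
      split_ifs <;> omega
    · rw [Nat.mod_eq_of_lt (by omega)]
      split_ifs <;> omega
  rw [hval, hval]
  constructor
  · rintro ⟨-, a, ha, ⟨h1, h2⟩ | ⟨h1, h2⟩⟩
    · have e1 := hv i.2 ha h1
      have e2 := hv j.2 (Set.mem_Iio.2 (Nat.mod_lt _ (by omega))) h2
      right
      rw [e1, e2]
    · have e1 := hv j.2 ha h1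
      have e2 := hv i.2 (Set.mem_Iio.2 (Nat.mod_lt _ (by omega))) h2
      left
      rw [e1, e2]
  · intro h
    have hne : i.val ≠ j.val := by
      have := i.2
      have := j.2
      rw [succ_mod_eq i.2, succ_mod_eq j.2] at h
      split_ifs at h <;> omega
    refine ⟨fun e => hne (hv i.2 j.2 e), ?_⟩
    rcases h with h | h
    · exact ⟨j, j.2, Or.inr ⟨rfl, by rw [← h]⟩⟩
    · exact ⟨i, i.2, Or.inl ⟨rfl, by rw [← h]⟩⟩

theorem cycleSubgraph_edgeSet_subset {ℓ : ℕ} {v : ℕ → V} :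
    (cycleSubgraph ℓ v).edgeSet ⊆ (fun i => s(v i, v ((i + 1) % ℓ))) '' Set.Iio ℓ := by
  intro e
  induction e with
  | h a b =>
    rw [Subgraph.mem_edgeSet]
    rintro ⟨-, i, hi, ⟨rfl, rfl⟩ | ⟨rfl, rfl⟩⟩
    · exact ⟨i, hi, rfl⟩
    · exact ⟨i, hi, Sym2.eq_swap⟩

theorem cycleSubgraph_ncard_edgeSet_le {ℓ : ℕ} {v : ℕ → V} :
    (cycleSubgraph ℓ v).edgeSet.ncard ≤ ℓ := by
  refine (Set.ncard_le_ncard cycleSubgraph_edgeSet_subset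
    ((Set.finite_Iio ℓ).image _)).trans ((Set.ncard_image_le (Set.finite_Iio ℓ)).trans ?_)
  rw [← Finset.coe_Iio, Set.ncard_coe_finset, Nat.card_Iio]

theorem cycleSubgraph_congr {ℓ : ℕ} {v w : ℕ → V} (h : ∀ i < ℓ, v i = w i) :
    cycleSubgraph ℓ v = cycleSubgraph ℓ w := by
  have hm : ∀ i < ℓ, v ((i + 1) % ℓ) = w ((i + 1) % ℓ) := fun i hi =>
    h _ (Nat.mod_lt _ (by omega))
  ext a b
  · rw [cycleSubgraph_verts, cycleSubgraph_verts, Set.image_congr (s := Set.Iio ℓ) h]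
  · rw [cycleSubgraph_adj, cycleSubgraph_adj]
    refine and_congr_right fun _ => exists_congr fun i => and_congr_right fun hi => ?_
    rw [h i hi, hm i hi]

/-- Rotating the vertex sequence by `m` places does not change the cycle. -/
theorem cycleSubgraph_rotate {ℓ : ℕ} (v : ℕ → V) (m : ℕ) :
    cycleSubgraph ℓ (fun i => v ((i + m) % ℓ)) = cycleSubgraph ℓ v := by
  have key : ∀ i < ℓ, ∃ j < ℓ, (j + m) % ℓ = i := by
    intro i hi
    refine ⟨(i + (ℓ - m % ℓ)) % ℓ, Nat.mod_lt _ (by omega), ?_⟩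
    have hm : m % ℓ < ℓ := Nat.mod_lt _ (by omega)
    rw [Nat.add_mod, Nat.mod_mod, ← Nat.add_mod_mod, ← Nat.add_mod, Nat.add_mod_mod,
      ← Nat.add_mod_mod]
    rw [show i + (ℓ - m % ℓ) + m % ℓ = i + ℓ by omega, Nat.add_mod_right, Nat.mod_eq_of_lt hi]
  have hs : ∀ i, ((i + 1) % ℓ + m) % ℓ = ((i + m) % ℓ + 1) % ℓ := by
    intro i
    rw [Nat.mod_add_mod, Nat.mod_add_mod, Nat.add_right_comm]
  ext a b
  · simp only [cycleSubgraph_verts, Set.mem_image, Set.mem_Iio]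
    constructor
    · rintro ⟨i, hi, rfl⟩
      exact ⟨_, Nat.mod_lt _ (by omega), rfl⟩
    · rintro ⟨i, hi, rfl⟩
      obtain ⟨j, hj, rfl⟩ := key i hi
      exact ⟨j, hj, rfl⟩
  · simp only [cycleSubgraph_adj, hs]
    refine and_congr_right fun _ => ?_
    constructor
    · rintro ⟨i, hi, h⟩
      exact ⟨_, Nat.mod_lt _ (by omega), h⟩
    · rintro ⟨i, hi, h⟩
      obtain ⟨j, hj, rfl⟩ := key i hi
      exact ⟨j, hj, h⟩

/-- Reversing the vertex sequence, keeping its first vertex, does not change the cycle. -/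
theorem cycleSubgraph_reverse {ℓ : ℕ} (v : ℕ → V) :
    cycleSubgraph ℓ (fun i => v ((ℓ - i) % ℓ)) = cycleSubgraph ℓ v := by
  have hs : ∀ i < ℓ, ((ℓ - (i + 1) % ℓ) % ℓ + 1) % ℓ = (ℓ - i) % ℓ := by
    intro i hi
    rw [succ_mod_eq hi]
    split_ifs with h
    · rw [Nat.sub_zero, Nat.mod_self, show ℓ - i = 0 + 1 by omega]
    · rw [Nat.mod_add_mod, show ℓ - (i + 1) + 1 = ℓ - i by omega]
  have hr : ∀ i < ℓ, (ℓ - (ℓ - i) % ℓ) % ℓ = i := by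
    intro i hi
    rcases Nat.eq_zero_or_pos i with rfl | h
    · simp
    · rw [Nat.mod_eq_of_lt (show ℓ - i < ℓ by omega), show ℓ - (ℓ - i) = i by omega,
        Nat.mod_eq_of_lt hi]
  have aux : ∀ (w : ℕ → V) a b, (cycleSubgraph ℓ (fun i => w ((ℓ - i) % ℓ))).Adj a b →
      (cycleSubgraph ℓ w).Adj a b := by
    rintro w a b ⟨hab, i, hi, h⟩
    refine ⟨hab, (ℓ - (i + 1) % ℓ) % ℓ, Nat.mod_lt _ (by omega), ?_⟩
    rw [hs i hi]
    tauto
  ext a b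
  · simp only [cycleSubgraph_verts, Set.mem_image, Set.mem_Iio]
    constructor
    · rintro ⟨i, hi, rfl⟩
      exact ⟨_, Nat.mod_lt _ (by omega), rfl⟩
    · rintro ⟨i, hi, rfl⟩
      exact ⟨(ℓ - i) % ℓ, Nat.mod_lt _ (by omega), by simp only [hr i hi]⟩
  · refine ⟨aux v a b, fun h => aux (fun i => v ((ℓ - i) % ℓ)) a b ?_⟩
    rwa [cycleSubgraph_congr (w := v) fun i hi => by simp only [hr i hi]]

end Cycles

/-! ### Translates and developments -/

section Translates

variable {n : ℕ}

theorem translate_none (t : ZMod n) : translate t none = none := rfl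

theorem translate_some (t a : ZMod n) (i : Fin 2) :
    translate t (some (a, i)) = some (a + t, i) := rfl

theorem translate_zero : (translate (0 : ZMod n)) = 1 := by
  ext v : 1
  rcases v with - | ⟨a, i⟩
  · rfl
  · rw [translate_some, add_zero]; rfl

theorem translate_translate (s t : ZMod n) (v : Vertex n) :
    translate s (translate t v) = translate (t + s) v := by
  rcases v with - | ⟨a, i⟩
  · rfl
  · simp only [translate_some, add_assoc]

theorem translateSubgraph_cycleSubgraph (t : ZMod n) (ℓ : ℕ) (v : ℕ → Vertex n) :
    translateSubgraph t (cycleSubgraph ℓ v) = cycleSubgraph ℓ (fun i => translate t (v i)) := by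
  ext a b
  · change a ∈ (translate t) '' _ ↔ _
    simp only [cycleSubgraph_verts, Set.image_image]
  · change Relation.Map _ (translate t) (translate t) a b ↔ _
    constructor
    · rintro ⟨a, b, ⟨hab, i, hi, h⟩, rfl, rfl⟩
      refine ⟨fun e => hab ((translate t).injective e), i, hi, ?_⟩
      rcases h with ⟨rfl, rfl⟩ | ⟨rfl, rfl⟩
      · exact Or.inl ⟨rfl, rfl⟩
      · exact Or.inr ⟨rfl, rfl⟩
    · rintro ⟨hab, i, hi, ⟨rfl, rfl⟩ | ⟨rfl, rfl⟩⟩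
      · exact ⟨_, _, ⟨fun e => hab (congrArg _ e), i, hi, Or.inl ⟨rfl, rfl⟩⟩, rfl, rfl⟩
      · exact ⟨_, _, ⟨fun e => hab (congrArg _ e), i, hi, Or.inr ⟨rfl, rfl⟩⟩, rfl, rfl⟩

theorem translateSubgraph_adj {t : ZMod n} {C : (completeGraph (Vertex n)).Subgraph}
    {a b : Vertex n} (h : C.Adj a b) :
    (translateSubgraph t C).Adj (translate t a) (translate t b) :=
  ⟨a, b, h, rfl, rfl⟩

theorem translateSubgraph_zero (C : (completeGraph (Vertex n)).Subgraph) :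
    translateSubgraph 0 C = C := by
  ext a b
  · change a ∈ (translate (0 : ZMod n)) '' _ ↔ _
    simp [translate_zero]
  · change Relation.Map _ (translate (0 : ZMod n)) (translate (0 : ZMod n)) a b ↔ _
    simp [translate_zero, Relation.Map]

theorem translateSubgraph_translateSubgraph (s t : ZMod n)
    (C : (completeGraph (Vertex n)).Subgraph) :
    translateSubgraph s (translateSubgraph t C) = translateSubgraph (t + s) C := by
  have : ⇑(translate (t + s)) = translate s ∘ translate t := by
    funext v
    exact (translate_translate s t v).symm
  ext a b
  · change a ∈ (translate s) '' ((translate t) '' _) ↔ a ∈ (translate (t + s)) '' _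
    rw [this, Set.image_comp]
  · change Relation.Map (Relation.Map _ (translate t) (translate t)) (translate s) (translate s) a b
      ↔ Relation.Map _ (translate (t + s)) (translate (t + s)) a b
    rw [Relation.map_map, this]

/-- If `m` is a period of `C`, then its translates depend only on the residue modulo `m`. -/
theorem translateSubgraph_val_mod [NeZero n] {C : (completeGraph (Vertex n)).Subgraph} {m : ℕ}
    (h : translateSubgraph (m : ZMod n) C = C) (t : ZMod n) :
    translateSubgraph ((t.val % m : ℕ) : ZMod n) C = translateSubgraph t C := by
  have hq : ∀ q : ℕ, translateSubgraph ((m * q : ℕ) : ZMod n) C = C := by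
    intro q
    induction q with
    | zero => simpa using translateSubgraph_zero C
    | succ q ih =>
      rw [Nat.mul_succ, Nat.cast_add, ← translateSubgraph_translateSubgraph, ih, h]
  conv_rhs => rw [← ZMod.natCast_zmod_val t, ← Nat.div_add_mod t.val m, Nat.cast_add,
    ← translateSubgraph_translateSubgraph, hq]

theorem ncard_development_le [NeZero n] {C : (completeGraph (Vertex n)).Subgraph} {m : ℕ}
    (hm : 0 < m) (h : translateSubgraph (m : ZMod n) C = C) : (development C).ncard ≤ m := by
  have hsub : development C ⊆ (fun r : ℕ => translateSubgraph (r : ZMod n) C) '' Set.Iio m := by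
    rintro _ ⟨t, rfl⟩
    exact ⟨t.val % m, Nat.mod_lt _ hm, translateSubgraph_val_mod h t⟩
  refine (Set.ncard_le_ncard hsub ((Set.finite_Iio m).image _)).trans
    ((Set.ncard_image_le (Set.finite_Iio m)).trans ?_)
  rw [← Finset.coe_Iio, Set.ncard_coe_finset, Nat.card_Iio]

theorem development_finite [NeZero n] (C : (completeGraph (Vertex n)).Subgraph) :
    (development C).Finite := Set.finite_range _

end Translates

/-! ### Coverings that are decompositions by counting -/

section Counting

/-- If finite sets cover `E` and their sizes add up to at most `#E`, then they partition `E`. -/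
theorem existsUnique_mem_of_sum_card_le {ι β : Type*} [DecidableEq β] {s : Finset ι}
    {E : Finset β} {f : ι → Finset β} (hcover : ∀ e ∈ E, ∃ i ∈ s, e ∈ f i)
    (hcard : ∑ i ∈ s, (f i).card ≤ E.card) : ∀ e ∈ E, ∃! i, i ∈ s ∧ e ∈ f i := by
  classical
  have hdc : ∑ i ∈ s, (E.filter fun e => e ∈ f i).card =
      ∑ e ∈ E, (s.filter fun i => e ∈ f i).card :=
    Finset.sum_card_bipartiteAbove_eq_sum_card_bipartiteBelow (fun i e => e ∈ f i)
  have hle : ∑ i ∈ s, (E.filter fun e => e ∈ f i).card ≤ ∑ i ∈ s, (f i).card :=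
    Finset.sum_le_sum fun i _ => Finset.card_le_card fun e he => (Finset.mem_filter.1 he).2
  have hone : ∀ e ∈ E, 1 ≤ (s.filter fun i => e ∈ f i).card := by
    intro e he
    obtain ⟨i, hi, hei⟩ := hcover e he
    exact Finset.card_pos.2 ⟨i, Finset.mem_filter.2 ⟨hi, hei⟩⟩
  have hsum : ∑ e ∈ E, (s.filter fun i => e ∈ f i).card ≤ ∑ _e ∈ E, 1 := by
    rw [← hdc, Finset.sum_const, smul_eq_mul, mul_one]
    exact hle.trans hcard
  have heq := (Finset.sum_eq_sum_iff_of_le hone).1 (le_antisymm (Finset.sum_le_sum hone) hsum)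
  intro e he
  obtain ⟨i, hi⟩ := Finset.card_eq_one.1 (heq e he).symm
  have hi' : ∀ j, j ∈ s ∧ e ∈ f j ↔ j = i := by
    intro j
    rw [← Finset.mem_filter (p := fun i => e ∈ f i), hi, Finset.mem_singleton]
  exact ⟨i, (hi' i).2 rfl, fun j hj => (hi' j).1 hj⟩

/-- A counting criterion: if the translates of the six base cycles cover all edges, then they
form a decomposition and the orbits have the largest sizes that the periods permit. -/
theorem isCycleDecomposition_of_cover {ℓ : ℕ} (hℓ : 3 ≤ ℓ) (v : Fin 6 → ℕ → Vertex (2 * ℓ))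
    (hinj : ∀ i, Set.InjOn (v i) (Set.Iio ℓ))
    (hper : ∀ i, translateSubgraph ((![2 * ℓ, 2 * ℓ, 2 * ℓ, ℓ, ℓ, 2] i : ℕ) : ZMod (2 * ℓ))
      (cycleSubgraph ℓ (v i)) = cycleSubgraph ℓ (v i))
    (hcover : ∀ e ∈ (completeGraph (Vertex (2 * ℓ))).edgeSet,
      ∃ i, ∃ C ∈ development (cycleSubgraph ℓ (v i)), e ∈ C.edgeSet) :
    IsCycleDecomposition (completeGraph (Vertex (2 * ℓ))) ℓ
      (⋃ i, development (cycleSubgraph ℓ (v i))) ∧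
    ∀ i, (development (cycleSubgraph ℓ (v i))).ncard = ![2 * ℓ, 2 * ℓ, 2 * ℓ, ℓ, ℓ, 2] i := by
  classical
  have : NeZero (2 * ℓ) := ⟨by omega⟩
  set D : Fin 6 → Set (completeGraph (Vertex (2 * ℓ))).Subgraph :=
    fun i => development (cycleSubgraph ℓ (v i)) with hD
  set N : Fin 6 → ℕ := ![2 * ℓ, 2 * ℓ, 2 * ℓ, ℓ, ℓ, 2] with hN
  have hNsum : ∑ i, N i = 8 * ℓ + 2 := by
    simp only [hN, Fin.sum_univ_six]
    simp
    ring
  have hNpos : ∀ i, 0 < N i := by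
    intro i
    fin_cases i <;> simp [hN] <;> omega
  have hDN : ∀ i, (D i).ncard ≤ N i := fun i => ncard_development_le (hNpos i) (hper i)
  have hfin : ∀ i, (D i).Finite := fun i => development_finite _
  set 𝒟 : Fin 6 → Finset (completeGraph (Vertex (2 * ℓ))).Subgraph :=
    fun i => (hfin i).toFinset with h𝒟
  have h𝒟card : ∀ i, (𝒟 i).card = (D i).ncard := fun i =>
    (Set.ncard_eq_toFinset_card _ (hfin i)).symm
  set 𝒞 := Finset.univ.biUnion 𝒟 with h𝒞
  have hmem : ∀ C, C ∈ 𝒞 ↔ C ∈ ⋃ i, D i := by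
    intro C
    simp [h𝒞, h𝒟]
  have hcyc : ∀ C ∈ 𝒞, ∃ w : ℕ → Vertex (2 * ℓ), Set.InjOn w (Set.Iio ℓ) ∧
      C = cycleSubgraph ℓ w := by
    intro C hC
    obtain ⟨i, t, rfl⟩ := Set.mem_iUnion.1 ((hmem C).1 hC)
    exact ⟨_, (translate t).injective.comp_injOn (hinj i),
      translateSubgraph_cycleSubgraph t ℓ (v i)⟩
  set f : (completeGraph (Vertex (2 * ℓ))).Subgraph → Finset (Sym2 (Vertex (2 * ℓ))) :=
    fun C => C.edgeSet.toFinset with hf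
  have hfcard : ∀ C ∈ 𝒞, (f C).card ≤ ℓ := by
    intro C hC
    obtain ⟨w, -, rfl⟩ := hcyc C hC
    rw [hf, ← Set.ncard_eq_toFinset_card']
    exact cycleSubgraph_ncard_edgeSet_le
  set E := (completeGraph (Vertex (2 * ℓ))).edgeFinset with hE
  have hEcard : E.card = ℓ * (8 * ℓ + 2) := by
    rw [hE, card_edgeFinset_top_eq_card_choose_two, ← Nat.card_eq_fintype_card,
      card_vertex _ (by omega), Nat.choose_two_right]
    exact Nat.div_eq_of_eq_mul_left (by norm_num) (by
      rw [show 2 * (2 * ℓ) + 1 - 1 = 4 * ℓ by omega]; ring)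
  have hcov : ∀ e ∈ E, ∃ C ∈ 𝒞, e ∈ f C := by
    intro e he
    obtain ⟨i, C, hC, heC⟩ := hcover e (mem_edgeFinset.1 he)
    exact ⟨C, (hmem C).2 (Set.mem_iUnion.2 ⟨i, hC⟩), Set.mem_toFinset.2 heC⟩
  -- With `ℓ * (8 * ℓ + 2)` edges to cover, none of the following inequalities can be strict.
  have h1 : 𝒞.card ≤ ∑ i, (𝒟 i).card := Finset.card_biUnion_le
  have h2 : ∑ i, (𝒟 i).card ≤ ∑ i, N i :=
    Finset.sum_le_sum fun i _ => (h𝒟card i).trans_le (hDN i)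
  have h3 : ∑ C ∈ 𝒞, (f C).card ≤ 𝒞.card * ℓ := Finset.sum_le_card_nsmul _ _ _ hfcard
  have h4 : E.card ≤ ∑ C ∈ 𝒞, (f C).card := by
    refine (Finset.card_le_card fun e he => ?_).trans (Finset.card_biUnion_le (t := f))
    obtain ⟨C, hC, heC⟩ := hcov e he
    exact Finset.mem_biUnion.2 ⟨C, hC, heC⟩
  have h5 : 8 * ℓ + 2 ≤ 𝒞.card := by
    refine Nat.le_of_mul_le_mul_left ?_ (show 0 < ℓ by omega)
    rw [← hEcard, mul_comm ℓ]
    exact h4.trans h3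
  refine ⟨⟨fun C hC => ?_, fun e he => ?_⟩, fun i => ?_⟩
  · obtain ⟨w, hw, rfl⟩ := hcyc C ((hmem C).2 hC)
    exact cycleSubgraph_iso hℓ hw
  · have hle : ∑ C ∈ 𝒞, (f C).card ≤ E.card := by
      rw [hEcard, mul_comm ℓ]
      exact h3.trans (Nat.mul_le_mul_right _ (by omega))
    obtain ⟨C, ⟨hC, heC⟩, huniq⟩ :=
      existsUnique_mem_of_sum_card_le hcov hle e (mem_edgeFinset.2 he)
    refine ⟨C, ⟨(hmem C).1 hC, Set.mem_toFinset.1 heC⟩, fun C' hC' => ?_⟩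
    exact huniq C' ⟨(hmem C').2 hC'.1, Set.mem_toFinset.2 hC'.2⟩
  · have hsum : ∑ i, (𝒟 i).card = ∑ i, N i := by omega
    have := (Finset.sum_eq_sum_iff_of_le fun i _ => (h𝒟card i).trans_le (hDN i)).1 hsum i
      (Finset.mem_univ i)
    rw [← this, h𝒟card]

end Counting

/-! ### Equitable colourings from matchings that exchange the colours -/

section Colours

/-- Exchange of the two parts. -/
def swapPart {n : ℕ} : Vertex n → Vertex n :=
  Option.map fun a => (a.1, 1 - a.2)

/-- The antipodal map `a_i ↦ (a + ℓ)_i`, fixing `∞`. -/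
def antipode {ℓ : ℕ} (v : Vertex (2 * ℓ)) : Vertex (2 * ℓ) := translate (ℓ : ZMod (2 * ℓ)) v

theorem val_add_half_lt_iff {ℓ : ℕ} (hℓ : 0 < ℓ) (a : ZMod (2 * ℓ)) :
    (a + (ℓ : ZMod (2 * ℓ))).val < ℓ ↔ ¬ a.val < ℓ := by
  have : NeZero (2 * ℓ) := ⟨by omega⟩
  have ha := ZMod.val_lt a
  have hval : (ℓ : ZMod (2 * ℓ)).val = ℓ := ZMod.val_cast_of_lt (by omega)
  rw [ZMod.val_add, hval]
  rcases lt_or_ge a.val ℓ with h | h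
  · rw [Nat.mod_eq_of_lt (by omega)]
    omega
  · rw [show a.val + ℓ = a.val - ℓ + 2 * ℓ by omega, Nat.add_mod_right, Nat.mod_eq_of_lt (by omega)]
    omega

theorem half_add_half (ℓ : ℕ) : (ℓ : ZMod (2 * ℓ)) + ℓ = 0 := by
  rw [← Nat.cast_add, ← two_mul, ZMod.natCast_self]

theorem antipode_antipode {ℓ : ℕ} (v : Vertex (2 * ℓ)) : antipode (antipode v) = v := by
  rw [antipode, antipode, translate_translate, half_add_half, translate_zero]
  rfl

theorem swapPart_swapPart {n : ℕ} (v : Vertex n) : swapPart (swapPart v) = v := by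
  rcases v with - | ⟨a, i⟩
  · rfl
  · simp [swapPart]

theorem colouring_translate_antipode_ne {ℓ : ℕ} (hℓ : 0 < ℓ) (t : ZMod (2 * ℓ))
    {v : Vertex (2 * ℓ)} (hv : v ≠ none) :
    colouring ℓ (translate t (antipode v)) ≠ colouring ℓ (translate t v) := by
  rcases v with - | ⟨a, i⟩
  · exact absurd rfl hv
  · have h := val_add_half_lt_iff hℓ (a + t)
    rw [add_right_comm] at h
    simp only [antipode, translate_some, colouring, h]
    by_cases h1 : (a + t).val < ℓ <;> by_cases h2 : i = 0 <;> simp [h1, h2]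

theorem colouring_translate_swapPart_ne {ℓ : ℕ} (t : ZMod (2 * ℓ))
    {v : Vertex (2 * ℓ)} (hv : v ≠ none) :
    colouring ℓ (translate t (swapPart v)) ≠ colouring ℓ (translate t v) := by
  rcases v with - | ⟨a, i⟩
  · exact absurd rfl hv
  · simp only [swapPart, Option.map_some, translate_some, colouring]
    by_cases h1 : (a + t).val < ℓ <;> fin_cases i <;> simp [h1]

theorem colour_eq_or (c : Colour) : c = Colour.red ∨ c = Colour.blue := by
  cases c <;> simp

theorem card_colour : Fintype.card Colour = 2 := rfl

/-- A set of `2k + 1` points in which all but one are matched in pairs of distinct colours has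
`k` or `k + 1` points of each colour. -/
theorem card_filter_colour_of_matching {V : Type*} [DecidableEq V] {k : ℕ} {T : Finset V}
    (hT : T.card = 2 * k + 1) (φ : V → Colour) {v₀ : V} (h₀ : v₀ ∈ T) (π : V → V)
    (hππ : ∀ v, π (π v) = v) (hπ : ∀ v ∈ T, v ≠ v₀ → π v ∈ T ∧ π v ≠ v₀ ∧ φ (π v) ≠ φ v)
    (s : Colour) :
    (T.filter fun v => φ v = s).card = k ∨ (T.filter fun v => φ v = s).card = k + 1 := by
  have hflip : ∀ c d e : Colour, d ≠ c → (d = e ↔ c ≠ e) := by decide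
  set U := T.erase v₀ with hU
  have hUmem : ∀ v, v ∈ U → π v ∈ U := by
    intro v hv
    obtain ⟨h1, h2⟩ := Finset.mem_erase.1 hv
    exact Finset.mem_erase.2 ⟨(hπ v h2 h1).2.1, (hπ v h2 h1).1⟩
  have hUflip : ∀ v ∈ U, (φ (π v) = s ↔ φ v ≠ s) := by
    intro v hv
    obtain ⟨h1, h2⟩ := Finset.mem_erase.1 hv
    exact hflip _ _ _ (hπ v h2 h1).2.2
  have hbij : (U.filter fun v => φ v = s).card = (U.filter fun v => ¬ φ v = s).card := by
    refine Finset.card_nbij' π π ?_ ?_ (fun v _ => hππ v) (fun v _ => hππ v)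
    · intro v hv
      obtain ⟨h1, h2⟩ := Finset.mem_filter.1 hv
      exact Finset.mem_filter.2 ⟨hUmem v h1, fun h => (hUflip v h1).1 h h2⟩
    · intro v hv
      obtain ⟨h1, h2⟩ := Finset.mem_filter.1 hv
      exact Finset.mem_filter.2 ⟨hUmem v h1, (hUflip v h1).2 h2⟩
  have hUcard : U.card = 2 * k := by
    rw [hU, Finset.card_erase_of_mem h₀]
    omega
  have hadd := Finset.card_filter_add_card_filter_not (s := U) (fun v => φ v = s)
  have hTU : T = insert v₀ U := (Finset.insert_erase h₀).symm
  have hnot : v₀ ∉ U := Finset.notMem_erase _ _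
  rw [hTU, Finset.filter_insert]
  split_ifs
  · rw [Finset.card_insert_of_notMem fun h => hnot (Finset.mem_filter.1 h).1]
    omega
  · omega

theorem ceilDiv_two_odd (k : ℕ) : (2 * k + 1) ⌈/⌉ 2 = k + 1 := by
  rw [Nat.ceilDiv_eq_add_pred_div]
  omega

/-- The equitability condition for the translates of a cycle, in terms of its vertex sequence. -/
theorem ncard_colour_translateSubgraph {ℓ : ℕ} (t : ZMod (2 * ℓ))
    {v : ℕ → Vertex (2 * ℓ)} (s : Colour) :
    {x | x ∈ (translateSubgraph t (cycleSubgraph ℓ v)).verts ∧ colouring ℓ x = s}.ncard =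
      (((Finset.range ℓ).image v).filter fun x => colouring ℓ (translate t x) = s).card := by
  rw [translateSubgraph_cycleSubgraph, cycleSubgraph_verts,
    ← Finset.card_image_of_injective _ (translate t).injective, ← Set.ncard_coe_finset]
  congr 1
  ext x
  simp only [Set.mem_ofPred_eq, Set.mem_image, Set.mem_Iio, Finset.coe_image, Finset.coe_filter,
    Finset.mem_image, Finset.mem_range]
  constructor
  · rintro ⟨⟨i, hi, rfl⟩, h⟩
    exact ⟨v i, ⟨⟨i, hi, rfl⟩, h⟩, rfl⟩
  · rintro ⟨_, ⟨⟨i, hi, rfl⟩, h⟩, rfl⟩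
    exact ⟨⟨i, hi, rfl⟩, h⟩

/-- All translates of a cycle are equitably coloured if all but one of its vertices are matched
by an involution that always exchanges the colours. -/
theorem isEquitableColouring_development {ℓ k : ℕ} (hk : ℓ = 2 * k + 1)
    {v : ℕ → Vertex (2 * ℓ)} (hv : Set.InjOn v (Set.Iio ℓ)) (π : Vertex (2 * ℓ) → Vertex (2 * ℓ))
    (hππ : ∀ x, π (π x) = x) {i₀ : ℕ} (hi₀ : i₀ < ℓ)
    (hcol : ∀ i < ℓ, i ≠ i₀ → ∀ t, colouring ℓ (translate t (π (v i))) ≠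
      colouring ℓ (translate t (v i)))
    (hπ : ∀ i < ℓ, i ≠ i₀ → ∃ j < ℓ, j ≠ i₀ ∧ π (v i) = v j) :
    IsEquitableColouring ℓ (development (cycleSubgraph ℓ v)) (colouring ℓ) := by
  rintro _ ⟨t, rfl⟩ s
  rw [ncard_colour_translateSubgraph t s, card_colour]
  have hT : ((Finset.range ℓ).image v).card = 2 * k + 1 := by
    rw [Finset.card_image_of_injOn (by simpa using hv), Finset.card_range, hk]
  have h := card_filter_colour_of_matching hT (fun x => colouring ℓ (translate t x))
    (Finset.mem_image_of_mem v (Finset.mem_range.2 hi₀)) π hππ ?_ s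
  · subst hk
    rw [ceilDiv_two_odd]
    omega
  · intro x hx hne
    obtain ⟨i, hi, rfl⟩ := Finset.mem_image.1 hx
    have hi := Finset.mem_range.1 hi
    have hii₀ : i ≠ i₀ := fun h => hne (h ▸ rfl)
    obtain ⟨j, hj, hjne, hij⟩ := hπ i hi hii₀
    refine ⟨hij ▸ Finset.mem_image_of_mem v (Finset.mem_range.2 hj), fun h => hjne ?_,
      hcol i hi hii₀ t⟩
    exact hv hj hi₀ (hij.symm.trans h)

end Colours

/-! ### Translation by one as a 2-rotational symmetry -/

section Rotation

variable {n : ℕ}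

theorem translate_one_zpow (z : ℤ) : translate (1 : ZMod n) ^ z = translate (z : ZMod n) := by
  have hadd : ∀ t : ZMod n, translate t * translate 1 = translate (t + 1) := fun t =>
    Equiv.ext fun v => (translate_translate t 1 v).trans (by rw [add_comm])
  induction z using Int.induction_on with
  | zero => rw [zpow_zero, Int.cast_zero, translate_zero]
  | succ i ih => rw [zpow_add_one, ih, hadd, Int.cast_add, Int.cast_one]
  | pred i ih =>
    rw [zpow_sub_one, ih, mul_inv_eq_iff_eq_mul, hadd, Int.cast_sub, Int.cast_one, sub_add_cancel]

theorem sameCycle_translate_one (a b : ZMod n) (i j : Fin 2) :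
    (translate (1 : ZMod n)).SameCycle (some (a, i)) (some (b, j)) ↔ i = j := by
  constructor
  · rintro ⟨z, hz⟩
    rw [translate_one_zpow, translate_some] at hz
    exact (Prod.ext_iff.1 (Option.some_injective _ hz)).2
  · rintro rfl
    refine ⟨((b - a).valMinAbs : ℤ), ?_⟩
    rw [translate_one_zpow, translate_some, ZMod.coe_valMinAbs, add_sub_cancel]

theorem minimalPeriod_translate_one (a : ZMod n) (i : Fin 2) :
    Function.minimalPeriod (translate (1 : ZMod n)) (some (a, i)) = n := by
  have hit : ∀ m : ℕ, (translate (1 : ZMod n))^[m] (some (a, i)) = some (a + m, i) := by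
    intro m
    rw [← Equiv.Perm.coe_pow, ← zpow_natCast, translate_one_zpow, translate_some, Int.cast_natCast]
  apply Nat.dvd_antisymm
  · refine Function.IsPeriodicPt.minimalPeriod_dvd ?_
    rw [Function.IsPeriodicPt, Function.IsFixedPt, hit, ZMod.natCast_self, add_zero]
  · have h := Function.iterate_minimalPeriod (f := translate (1 : ZMod n)) (x := some (a, i))
    rw [hit] at h
    have h' := (Prod.ext_iff.1 (Option.some_injective _ h)).1
    exact (ZMod.natCast_eq_zero_iff _ _).1 (add_eq_left.1 h')

theorem isTwoRotational_iUnion_development {ι : Type*} (hn : 1 < n)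
    (B : ι → (completeGraph (Vertex n)).Subgraph) :
    IsTwoRotational n (⋃ i, development (B i)) := by
  have hne : (1 : ZMod n) ≠ 0 := by
    have : Fact (1 < n) := ⟨hn⟩
    exact one_ne_zero
  refine ⟨Iso.completeGraph (translate 1), ?_, none, some (0, 0), some (0, 1), ?_, by omega,
    minimalPeriod_translate_one 0 0, minimalPeriod_translate_one 0 1, ?_, ?_⟩
  · change translateSubgraph (1 : ZMod n) '' _ = _
    rw [Set.image_iUnion]
    refine Set.iUnion_congr fun i => ?_
    ext C
    constructor
    · rintro ⟨_, ⟨t, rfl⟩, rfl⟩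
      exact ⟨t + 1, (translateSubgraph_translateSubgraph _ _ _).symm⟩
    · rintro ⟨t, rfl⟩
      refine ⟨_, ⟨t - 1, rfl⟩, ?_⟩
      rw [translateSubgraph_translateSubgraph, sub_add_cancel]
  · rintro (- | ⟨a, i⟩)
    · exact ⟨fun _ => rfl, fun _ => rfl⟩
    · refine ⟨fun h => ?_, fun h => nomatch h⟩
      change some (a + 1, i) = some (a, i) at h
      exact absurd (add_eq_left.1 (Prod.ext_iff.1 (Option.some_injective _ h)).1) hne
  · intro h
    exact absurd ((sameCycle_translate_one (0 : ZMod n) 0 0 1).1 h) (by decide)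
  · rintro (- | ⟨a, i⟩)
    · exact Or.inl rfl
    · right
      fin_cases i
      · exact Or.inl ((sameCycle_translate_one (0 : ZMod n) a 0 0).2 rfl)
      · exact Or.inr ((sameCycle_translate_one (0 : ZMod n) a 1 1).2 rfl)

theorem ncard_colour_classes {ℓ : ℕ} (hℓ : 0 < ℓ) :
    {v | colouring ℓ v = Colour.red}.ncard = 2 * ℓ ∧
    {v | colouring ℓ v = Colour.blue}.ncard = 2 * ℓ + 1 := by
  classical
  have : NeZero (2 * ℓ) := ⟨by omega⟩
  set R := Finset.univ.filter fun v => colouring ℓ v = Colour.red with hR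
  set B := Finset.univ.filter fun v => ¬ colouring ℓ v = Colour.red with hB
  have hflip : ∀ c d : Colour, d ≠ c → (d = Colour.red ↔ c ≠ Colour.red) := by decide
  have hanti : ∀ v : Vertex (2 * ℓ), v ≠ none →
      (colouring ℓ (antipode v) = Colour.red ↔ colouring ℓ v ≠ Colour.red) := by
    intro v hv
    have h := colouring_translate_antipode_ne hℓ 0 hv
    rw [translate_zero] at h
    exact hflip _ _ h
  have hnone : none ∈ B := Finset.mem_filter.2 ⟨Finset.mem_univ _, fun h => nomatch h⟩
  have hne : ∀ v : Vertex (2 * ℓ), v ≠ none → antipode v ≠ none := by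
    rintro (- | a) h
    · exact absurd rfl h
    · exact fun h => nomatch h
  have hbij : R.card = (B.erase none).card := by
    refine Finset.card_nbij' antipode antipode ?_ ?_ (fun v _ => antipode_antipode v)
      (fun v _ => antipode_antipode v)
    · intro v hv
      have hred := (Finset.mem_filter.1 hv).2
      have hv0 : v ≠ none := by
        rintro rfl
        exact nomatch hred
      exact Finset.mem_erase.2 ⟨hne v hv0, Finset.mem_filter.2 ⟨Finset.mem_univ _,
        fun h => (hanti v hv0).1 h hred⟩⟩
    · intro v hv
      obtain ⟨h1, h2⟩ := Finset.mem_erase.1 hv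
      exact Finset.mem_filter.2 ⟨Finset.mem_univ _, (hanti v h1).2 (Finset.mem_filter.1 h2).2⟩
  have hadd : R.card + B.card = 2 * (2 * ℓ) + 1 := by
    rw [hR, hB, Finset.card_filter_add_card_filter_not, Finset.card_univ,
      ← Nat.card_eq_fintype_card, card_vertex _ (by omega)]
  have hpos : 0 < B.card := Finset.card_pos.2 ⟨none, hnone⟩
  rw [Finset.card_erase_of_mem hnone] at hbij
  have hRset : {v | colouring ℓ v = Colour.red} = (R : Set (Vertex (2 * ℓ))) := by
    ext v
    simp [hR]
  have hBset : {v | colouring ℓ v = Colour.blue} = (B : Set (Vertex (2 * ℓ))) := by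
    ext v
    rcases colour_eq_or (colouring ℓ v) with h | h <;> simp [hB, h]
  rw [hRset, hBset, Set.ncard_coe_finset, Set.ncard_coe_finset]
  omega

end Rotation

/-! ### Differences along edges -/

section Differences

variable {n : ℕ}

/-- The vertex with first coordinate `a` modulo `n`, in part `0` if `s = 0` and in part `1`
otherwise. Integer labels make statements about explicit vertex sequences linear arithmetic. -/
def point (n : ℕ) (a s : ℤ) : Vertex n := some ((a : ZMod n), if s = 0 then 0 else 1)

theorem point_ne_none (a s : ℤ) : point n a s ≠ none := fun h => nomatch h

theorem point_eq_point_iff {a s b s' : ℤ} :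
    point n a s = point n b s' ↔ (n : ℤ) ∣ b - a ∧ (s = 0 ↔ s' = 0) := by
  rw [← ZMod.intCast_eq_intCast_iff_dvd_sub]
  simp only [point, Option.some_inj, Prod.mk.injEq]
  refine and_congr_right fun _ => ?_
  split_ifs <;> simp_all

theorem translate_point (t : ℤ) (a s : ℤ) :
    translate (t : ZMod n) (point n a s) = point n (a + t) s := by
  simp [point, translate_some]

theorem swapPart_point {a s : ℤ} (hs : s = 0 ∨ s = 1) :
    swapPart (point n a s) = point n a (1 - s) := by
  rcases hs with rfl | rfl <;> simp [swapPart, point]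

/-- `C` has an edge from part `p` to part `q` along which the first coordinate grows by `d`. -/
def HasDiff (C : (completeGraph (Vertex n)).Subgraph) (p q : Fin 2) (d : ZMod n) : Prop :=
  ∃ a, C.Adj (some (a, p)) (some (a + d, q))

theorem HasDiff.symm {C : (completeGraph (Vertex n)).Subgraph} {p q : Fin 2} {d : ZMod n}
    (h : HasDiff C p q d) : HasDiff C q p (-d) := by
  obtain ⟨a, ha⟩ := h
  exact ⟨a + d, by simpa using ha.symm⟩

theorem HasDiff.exists_mem_development {C : (completeGraph (Vertex n)).Subgraph} {p q : Fin 2}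
    {a b : ZMod n} (h : HasDiff C p q (b - a)) :
    ∃ C' ∈ development C, C'.Adj (some (a, p)) (some (b, q)) := by
  obtain ⟨c, hc⟩ := h
  refine ⟨_, ⟨a - c, rfl⟩, ?_⟩
  have := translateSubgraph_adj (t := a - c) hc
  rwa [translate_some, translate_some, add_sub_cancel,
    show c + (b - a) + (a - c) = b by ring] at this

theorem hasDiff_of_adj {C : (completeGraph (Vertex n)).Subgraph} {a s b s' d : ℤ}
    (h : C.Adj (point n a s) (point n b s')) (hd : b - a = d ∨ b - a = d + n ∨ b - a = d - n) :
    HasDiff C (if s = 0 then 0 else 1) (if s' = 0 then 0 else 1) (d : ZMod n) := by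
  have : ((b : ℤ) : ZMod n) = a + d := by
    rw [← sub_eq_iff_eq_add', ← Int.cast_sub]
    rcases hd with hd | hd | hd <;> simp [hd]
  refine ⟨a, ?_⟩
  rw [← this]
  exact h

theorem hasDiff_self_of_adj {C : (completeGraph (Vertex n)).Subgraph} {a s b d : ℤ}
    (h : C.Adj (point n a s) (point n b s))
    (hd : b - a = d ∨ b - a = d + n ∨ b - a = d - n ∨
      a - b = d ∨ a - b = d + n ∨ a - b = d - n) :
    HasDiff C (if s = 0 then 0 else 1) (if s = 0 then 0 else 1) (d : ZMod n) := by
  rcases hd with hd | hd | hd | hd | hd | hd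
  · exact hasDiff_of_adj h (by omega)
  · exact hasDiff_of_adj h (by omega)
  · exact hasDiff_of_adj h (by omega)
  · exact hasDiff_of_adj h.symm (by omega)
  · exact hasDiff_of_adj h.symm (by omega)
  · exact hasDiff_of_adj h.symm (by omega)

theorem hasDiff_zero_zero {C : (completeGraph (Vertex n)).Subgraph} {a s b s' d : ℤ}
    (h : C.Adj (point n a s) (point n b s'))
    (hd : s = 0 ∧ s' = 0 ∧ (b - a = d ∨ b - a = d + n ∨ b - a = d - n ∨
      a - b = d ∨ a - b = d + n ∨ a - b = d - n)) : HasDiff C 0 0 (d : ZMod n) := by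
  obtain ⟨rfl, rfl, hd⟩ := hd
  exact hasDiff_self_of_adj h hd

theorem hasDiff_one_one {C : (completeGraph (Vertex n)).Subgraph} {a s b s' d : ℤ}
    (h : C.Adj (point n a s) (point n b s'))
    (hd : s = 1 ∧ s' = 1 ∧ (b - a = d ∨ b - a = d + n ∨ b - a = d - n ∨
      a - b = d ∨ a - b = d + n ∨ a - b = d - n)) : HasDiff C 1 1 (d : ZMod n) := by
  obtain ⟨rfl, rfl, hd⟩ := hd
  exact hasDiff_self_of_adj h hd

theorem hasDiff_zero_one {C : (completeGraph (Vertex n)).Subgraph} {a s b s' d : ℤ}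
    (h : C.Adj (point n a s) (point n b s'))
    (hd : s = 0 ∧ s' = 1 ∧ (b - a = d ∨ b - a = d + n ∨ b - a = d - n) ∨
      s = 1 ∧ s' = 0 ∧ (a - b = d ∨ a - b = d + n ∨ a - b = d - n)) :
    HasDiff C 0 1 (d : ZMod n) := by
  rcases hd with ⟨rfl, rfl, hd⟩ | ⟨rfl, rfl, hd⟩
  · exact hasDiff_of_adj h hd
  · exact hasDiff_of_adj h.symm hd

end Differences

/-! ### Covering all edges by differences -/

section Covering

/-- A family of base cycles whose translates cover all edges: it suffices that every difference
occurs, where for `ℓ = 2k + 1` the mixed differences are written as `d` and `ℓ + d` with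
`|d| ≤ k`, and the pure ones, up to sign, as `d` and `ℓ - d` with `1 ≤ d ≤ k`, and `ℓ`. -/
theorem covers_of_hasDiff {ℓ k : ℕ} (hk : ℓ = 2 * k + 1) {ι : Type*}
    (C : ι → (completeGraph (Vertex (2 * ℓ))).Subgraph)
    (hpure : ∀ p : Fin 2, ∀ d : ℤ, 1 ≤ d → d ≤ k →
      (∃ i, HasDiff (C i) p p (d : ZMod (2 * ℓ))) ∧
      ∃ i, HasDiff (C i) p p ((ℓ - d : ℤ) : ZMod (2 * ℓ)))
    (hhalf : ∀ p : Fin 2, ∃ i, HasDiff (C i) p p ((ℓ : ℤ) : ZMod (2 * ℓ)))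
    (hmixed : ∀ d : ℤ, -k ≤ d → d ≤ k →
      (∃ i, HasDiff (C i) 0 1 (d : ZMod (2 * ℓ))) ∧
      ∃ i, HasDiff (C i) 0 1 ((ℓ + d : ℤ) : ZMod (2 * ℓ)))
    (hinf : ∀ p : Fin 2, ∃ i, ∃ a, (C i).Adj none (some (a, p))) :
    ∀ e ∈ (completeGraph (Vertex (2 * ℓ))).edgeSet,
      ∃ i, ∃ C' ∈ development (C i), e ∈ C'.edgeSet := by
  have : NeZero (2 * ℓ) := ⟨by omega⟩
  have hℓ' : ((2 * ℓ : ℕ) : ZMod (2 * ℓ)) = 0 := ZMod.natCast_self _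
  push_cast at hℓ'
  -- Representatives of the residues modulo `2ℓ` in the two ranges.
  have hrep : ∀ c : ZMod (2 * ℓ), ∃ d : ℤ, -k ≤ d ∧ d ≤ k ∧
      (c = (d : ZMod (2 * ℓ)) ∨ c = ((ℓ + d : ℤ) : ZMod (2 * ℓ))) := by
    intro c
    have hc := ZMod.val_lt c
    have hval : ((c.val : ℤ) : ZMod (2 * ℓ)) = c := by simp
    rcases le_or_gt c.val k with h1 | h1
    · exact ⟨c.val, by omega, by omega, Or.inl hval.symm⟩
    rcases le_or_gt c.val (3 * k + 1) with h2 | h2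
    · refine ⟨c.val - ℓ, by omega, by omega, Or.inr ?_⟩
      rw [add_sub_cancel, hval]
    · refine ⟨c.val - 2 * ℓ, by omega, by omega, Or.inl ?_⟩
      rw [Int.cast_sub, hval]
      push_cast
      rw [hℓ', sub_zero]
  have hmix : ∀ c : ZMod (2 * ℓ), ∃ i, HasDiff (C i) 0 1 c := by
    intro c
    obtain ⟨d, h1, h2, rfl | rfl⟩ := hrep c
    · exact (hmixed d h1 h2).1
    · exact (hmixed d h1 h2).2
  have hpur : ∀ p, ∀ c : ZMod (2 * ℓ), c ≠ 0 → ∃ i, HasDiff (C i) p p c := by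
    intro p c hc
    obtain ⟨d, h1, h2, rfl | rfl⟩ := hrep c
    · rcases lt_trichotomy d 0 with h | rfl | h
      · obtain ⟨i, hi⟩ := (hpure p (-d) (by omega) (by omega)).1
        exact ⟨i, by simpa using hi.symm⟩
      · simp at hc
      · exact (hpure p d (by omega) h2).1
    · rcases lt_trichotomy d 0 with h | rfl | h
      · obtain ⟨i, hi⟩ := (hpure p (-d) (by omega) (by omega)).2
        exact ⟨i, by simpa using hi⟩
      · simpa using hhalf p
      · obtain ⟨i, hi⟩ := (hpure p d (by omega) h2).2
        refine ⟨i, ?_⟩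
        have := hi.symm
        rwa [show (-((ℓ - d : ℤ) : ZMod (2 * ℓ))) = ((ℓ + d : ℤ) : ZMod (2 * ℓ)) by
          push_cast; linear_combination -hℓ'] at this
  have hsome : ∀ a b : ZMod (2 * ℓ), ∀ p q, (some (a, p) : Vertex (2 * ℓ)) ≠ some (b, q) →
      ∃ i, ∃ C' ∈ development (C i), C'.Adj (some (a, p)) (some (b, q)) := by
    intro a b p q hne
    have hcase : p = q ∨ (p = 0 ∧ q = 1) ∨ (p = 1 ∧ q = 0) := by omega
    rcases hcase with rfl | ⟨rfl, rfl⟩ | ⟨rfl, rfl⟩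
    · obtain ⟨i, hi⟩ := hpur p (b - a) fun h => hne (by rw [sub_eq_zero.1 h])
      exact ⟨i, hi.exists_mem_development⟩
    · obtain ⟨i, hi⟩ := hmix (b - a)
      exact ⟨i, hi.exists_mem_development⟩
    · obtain ⟨i, hi⟩ := hmix (a - b)
      have := hi.symm
      rw [neg_sub] at this
      exact ⟨i, this.exists_mem_development⟩
  have hnone : ∀ (b : ZMod (2 * ℓ)) q,
      ∃ i, ∃ C' ∈ development (C i), C'.Adj none (some (b, q)) := by
    intro b q
    obtain ⟨i, a, ha⟩ := hinf q
    refine ⟨i, _, ⟨b - a, rfl⟩, ?_⟩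
    have := translateSubgraph_adj (t := b - a) ha
    rwa [translate_none, translate_some, add_sub_cancel] at this
  intro e
  induction e with
  | h u v =>
    intro huv
    have huv : u ≠ v := huv
    simp only [Subgraph.mem_edgeSet]
    rcases u with - | ⟨a, p⟩ <;> rcases v with - | ⟨b, q⟩
    · exact absurd rfl huv
    · exact hnone b q
    · obtain ⟨i, C', hC', h⟩ := hnone a p
      exact ⟨i, C', hC', h.symm⟩
    · exact hsome a b p q huv

end Covering

/-! ### Cycles of pairs of vertices with the same first coordinate -/

section MatchedCycles

/-- The vertex sequence with first coordinates `x` and parts `s` runs through `ℓ` distinct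
vertices, which apart from the one with index `i₀` form pairs `a_0, a_1`. -/
structure IsMatchedSeq (ℓ : ℕ) (x s : ℕ → ℤ) (i₀ : ℕ) : Prop where
  lt : i₀ < ℓ
  part : ∀ i < ℓ, s i = 0 ∨ s i = 1
  ne : ∀ i j, i < j → j < ℓ → s i = s j →
    x i ≠ x j ∧ x j - x i < 2 * ℓ ∧ x i - x j < 2 * ℓ
  matching : ∀ i < ℓ, i ≠ i₀ → ∃ j < ℓ, j ≠ i₀ ∧ x j = x i ∧ s j = 1 - s i

theorem IsMatchedSeq.injOn {ℓ : ℕ} {x s : ℕ → ℤ} {i₀ : ℕ} (h : IsMatchedSeq ℓ x s i₀) :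
    Set.InjOn (fun i => point (2 * ℓ) (x i) (s i)) (Set.Iio ℓ) := by
  have key : ∀ i j, i < j → j < ℓ → point (2 * ℓ) (x i) (s i) ≠ point (2 * ℓ) (x j) (s j) := by
    intro i j hij hj e
    obtain ⟨h1, h2⟩ := point_eq_point_iff.1 e
    have hi' := h.part i (by omega)
    have hj' := h.part j hj
    obtain ⟨h3, h4, h5⟩ := h.ne i j hij hj (by omega)
    have := Int.eq_zero_of_abs_lt_dvd h1 (abs_lt.2 ⟨by push_cast; omega, by push_cast; omega⟩)
    omega
  intro i hi j hj e
  rcases lt_trichotomy i j with hlt | rfl | hlt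
  · exact absurd e (key i j hlt hj)
  · rfl
  · exact absurd e.symm (key j i hlt hi)

theorem IsMatchedSeq.isEquitableColouring {ℓ k : ℕ} (hk : ℓ = 2 * k + 1) {x s : ℕ → ℤ} {i₀ : ℕ}
    (h : IsMatchedSeq ℓ x s i₀) :
    IsEquitableColouring ℓ
      (development (cycleSubgraph ℓ fun i => point (2 * ℓ) (x i) (s i))) (colouring ℓ) := by
  refine isEquitableColouring_development hk h.injOn swapPart swapPart_swapPart h.lt
    (fun i _ _ t => colouring_translate_swapPart_ne t (point_ne_none _ _)) fun i hi hne => ?_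
  obtain ⟨j, hj, hjne, hx, hs⟩ := h.matching i hi hne
  exact ⟨j, hj, hjne, by rw [swapPart_point (h.part i hi), hx, hs]⟩

end MatchedCycles

/-! ### Cycles through infinity -/

section AntipodalCycles

/-- The vertex sequence of the cycle `∞, x_0, …, x_{k-1}, x_{k-1} + ℓ, …, x_0 + ℓ`, where
`ℓ = 2k + 1` and the parts are given by `s`. -/
def antipodalSeq (ℓ k : ℕ) (x s : ℕ → ℤ) (i : ℕ) : Vertex (2 * ℓ) :=
  if i = 0 then none
  else if i ≤ k then point (2 * ℓ) (x (i - 1)) (s (i - 1))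
  else point (2 * ℓ) (x (2 * k - i) + ℓ) (s (2 * k - i))

theorem antipodalSeq_zero {ℓ k : ℕ} {x s : ℕ → ℤ} : antipodalSeq ℓ k x s 0 = none := rfl

theorem antipodalSeq_succ {ℓ k : ℕ} {x s : ℕ → ℤ} {i : ℕ} (hi : i < k) :
    antipodalSeq ℓ k x s (i + 1) = point (2 * ℓ) (x i) (s i) := by
  rw [antipodalSeq, if_neg (by omega), if_pos (by omega), Nat.add_sub_cancel]

theorem antipodalSeq_sub {ℓ k : ℕ} {x s : ℕ → ℤ} {i : ℕ} (hi : i < k) :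
    antipodalSeq ℓ k x s (2 * k - i) = point (2 * ℓ) (x i + ℓ) (s i) := by
  rw [antipodalSeq, if_neg (by omega), if_neg (by omega), show 2 * k - (2 * k - i) = i by omega]

theorem antipodalSeq_cases {k i : ℕ} (hi : i < 2 * k + 1) :
    i = 0 ∨ (∃ j < k, i = j + 1) ∨ ∃ j < k, i = 2 * k - j := by
  rcases Nat.eq_zero_or_pos i with h | h
  · exact Or.inl h
  rcases le_or_gt i k with h' | h'
  · exact Or.inr (Or.inl ⟨i - 1, by omega, by omega⟩)
  · exact Or.inr (Or.inr ⟨2 * k - i, by omega, by omega⟩)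

theorem antipode_point {ℓ : ℕ} {a s : ℤ} :
    antipode (point (2 * ℓ) a s) = point (2 * ℓ) (a + ℓ) s := by
  rw [antipode, ← translate_point, Int.cast_natCast]

theorem antipode_antipodalSeq {ℓ k : ℕ} {x s : ℕ → ℤ} {i : ℕ}
    (hi : i < 2 * k + 1) : antipode (antipodalSeq ℓ k x s i) =
      antipodalSeq ℓ k x s ((2 * k + 1 - i) % (2 * k + 1)) := by
  rcases antipodalSeq_cases hi with rfl | ⟨j, hj, rfl⟩ | ⟨j, hj, rfl⟩
  · rw [Nat.sub_zero, Nat.mod_self]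
    rfl
  · rw [Nat.mod_eq_of_lt (by omega), show 2 * k + 1 - (j + 1) = 2 * k - j by omega,
      antipodalSeq_succ hj, antipodalSeq_sub hj, antipode_point]
  · rw [Nat.mod_eq_of_lt (by omega), show 2 * k + 1 - (2 * k - j) = j + 1 by omega,
      antipodalSeq_succ hj, antipodalSeq_sub hj, ← antipode_point, antipode_antipode]

/-- The condition under which `antipodalSeq` runs through distinct vertices: the first
coordinates `x` within each part are distinct modulo `ℓ`. -/
def IsAntipodalTransversal (ℓ k : ℕ) (x s : ℕ → ℤ) : Prop :=
  ∀ i j, i < j → j < k → (s i = 0 ↔ s j = 0) →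
    x i ≠ x j ∧ x j - x i ≠ ℓ ∧ x i - x j ≠ ℓ ∧ x j - x i < 2 * ℓ ∧ x i - x j < 2 * ℓ

theorem IsAntipodalTransversal.injOn {ℓ k : ℕ} (hk : ℓ = 2 * k + 1) {x s : ℕ → ℤ}
    (h : IsAntipodalTransversal ℓ k x s) :
    Set.InjOn (antipodalSeq ℓ k x s) (Set.Iio ℓ) := by
  have hdvd : ∀ z : ℤ, ((2 * ℓ : ℕ) : ℤ) ∣ z → -ℓ < z → z < 3 * ℓ → z = 0 ∨ z = 2 * ℓ := by
    rintro z ⟨c, rfl⟩ h1 h2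
    push_cast at h1 h2 ⊢
    have hc1 : -1 < c := by nlinarith
    have hc2 : c < 2 := by nlinarith
    obtain rfl | rfl : c = 0 ∨ c = 1 := by omega
    · left; ring
    · right; ring
  -- Congruence of two first coordinates modulo `ℓ` forces equal indices.
  have hx : ∀ i j, i < k → j < k → (s i = 0 ↔ s j = 0) →
      (((2 * ℓ : ℕ) : ℤ) ∣ x j - x i ∨ ((2 * ℓ : ℕ) : ℤ) ∣ x j + ℓ - x i) → i = j := by
    intro i j hi hj hs hd
    rcases lt_trichotomy i j with hlt | rfl | hlt
    · obtain ⟨h1, h2, h3, h4, h5⟩ := h i j hlt hj hs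
      rcases hd with hd | hd
      · have := Int.eq_zero_of_abs_lt_dvd hd
          (abs_lt.2 ⟨by push_cast; omega, by push_cast; omega⟩)
        omega
      · rcases hdvd _ hd (by omega) (by omega) with h0 | h0 <;> omega
    · rfl
    · obtain ⟨h1, h2, h3, h4, h5⟩ := h j i hlt hi hs.symm
      rcases hd with hd | hd
      · have := Int.eq_zero_of_abs_lt_dvd hd
          (abs_lt.2 ⟨by push_cast; omega, by push_cast; omega⟩)
        omega
      · rcases hdvd _ hd (by omega) (by omega) with h0 | h0 <;> omega
  have hhalf : ∀ z : ℤ, ¬ ((2 * ℓ : ℕ) : ℤ) ∣ z + ℓ - z := by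
    intro z hz
    rcases hdvd _ hz (by omega) (by omega) with h0 | h0 <;> omega
  subst hk
  intro i hi j hj e
  rcases antipodalSeq_cases hi with rfl | ⟨i', hi', rfl⟩ | ⟨i', hi', rfl⟩ <;>
  rcases antipodalSeq_cases hj with rfl | ⟨j', hj', rfl⟩ | ⟨j', hj', rfl⟩
  · rfl
  · rw [antipodalSeq_succ hj'] at e
    exact nomatch e
  · rw [antipodalSeq_sub hj'] at e
    exact nomatch e
  · rw [antipodalSeq_succ hi'] at e
    exact nomatch e
  · rw [antipodalSeq_succ hi', antipodalSeq_succ hj'] at e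
    obtain ⟨h1, h2⟩ := point_eq_point_iff.1 e
    rw [hx i' j' hi' hj' h2 (Or.inl h1)]
  · rw [antipodalSeq_succ hi', antipodalSeq_sub hj'] at e
    obtain ⟨h1, h2⟩ := point_eq_point_iff.1 e
    obtain rfl := hx i' j' hi' hj' h2 (Or.inr h1)
    exact absurd h1 (hhalf _)
  · rw [antipodalSeq_sub hi'] at e
    exact nomatch e
  · rw [antipodalSeq_sub hi', antipodalSeq_succ hj'] at e
    obtain ⟨h1, h2⟩ := point_eq_point_iff.1 e.symm
    obtain rfl := hx j' i' hj' hi' h2 (Or.inr h1)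
    exact absurd h1 (hhalf _)
  · rw [antipodalSeq_sub hi', antipodalSeq_sub hj'] at e
    obtain ⟨h1, h2⟩ := point_eq_point_iff.1 e
    rw [hx i' j' hi' hj' h2 (Or.inl (by rwa [add_sub_add_right_eq_sub] at h1))]

theorem translateSubgraph_antipodalSeq {ℓ k : ℕ} (hk : ℓ = 2 * k + 1) (x s : ℕ → ℤ) :
    translateSubgraph (ℓ : ZMod (2 * ℓ)) (cycleSubgraph ℓ (antipodalSeq ℓ k x s)) =
      cycleSubgraph ℓ (antipodalSeq ℓ k x s) := by
  rw [translateSubgraph_cycleSubgraph]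
  conv_rhs => rw [← cycleSubgraph_reverse]
  refine cycleSubgraph_congr fun i hi => ?_
  have := antipode_antipodalSeq (ℓ := ℓ) (k := k) (x := x) (s := s) (i := i) (by omega)
  rwa [← hk] at this

theorem IsAntipodalTransversal.isEquitableColouring {ℓ k : ℕ} (hk : ℓ = 2 * k + 1)
    {x s : ℕ → ℤ} (h : IsAntipodalTransversal ℓ k x s) :
    IsEquitableColouring ℓ
      (development (cycleSubgraph ℓ (antipodalSeq ℓ k x s))) (colouring ℓ) := by
  refine isEquitableColouring_development hk (h.injOn hk) antipode antipode_antipode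
    (i₀ := 0) (by omega) (fun i hi hne t => ?_) fun i hi hne => ?_
  · refine colouring_translate_antipode_ne (by omega) t fun e => ?_
    have := h.injOn hk hi (show 0 < ℓ by omega) (e.trans antipodalSeq_zero.symm)
    exact hne this
  · refine ⟨2 * k + 1 - i, by omega, by omega, ?_⟩
    rw [antipode_antipodalSeq (by omega), Nat.mod_eq_of_lt (by omega)]

theorem IsAntipodalTransversal.adj_none {ℓ k : ℕ} (hk : ℓ = 2 * k + 1) (hk0 : 0 < k)
    {x s : ℕ → ℤ} (h : IsAntipodalTransversal ℓ k x s) :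
    (cycleSubgraph ℓ (antipodalSeq ℓ k x s)).Adj none (point (2 * ℓ) (x 0) (s 0)) := by
  have := cycleSubgraph_adj_succ (h.injOn hk) (i := 0) (by omega)
  rwa [antipodalSeq_zero, antipodalSeq_succ hk0] at this

theorem IsAntipodalTransversal.adj_succ {ℓ k : ℕ} (hk : ℓ = 2 * k + 1)
    {x s : ℕ → ℤ} (h : IsAntipodalTransversal ℓ k x s) (i : ℕ) (hi : i + 1 < k) :
    (cycleSubgraph ℓ (antipodalSeq ℓ k x s)).Adj
      (point (2 * ℓ) (x i) (s i)) (point (2 * ℓ) (x (i + 1)) (s (i + 1))) := by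
  have := cycleSubgraph_adj_succ (h.injOn hk) (i := i + 1) (by omega)
  rwa [antipodalSeq_succ (by omega), antipodalSeq_succ hi] at this

theorem IsAntipodalTransversal.adj_half {ℓ k : ℕ} (hk : ℓ = 2 * k + 1) (hk0 : 0 < k)
    {x s : ℕ → ℤ} (h : IsAntipodalTransversal ℓ k x s) :
    (cycleSubgraph ℓ (antipodalSeq ℓ k x s)).Adj
      (point (2 * ℓ) (x (k - 1)) (s (k - 1))) (point (2 * ℓ) (x (k - 1) + ℓ) (s (k - 1))) := by
  have := cycleSubgraph_adj_succ (h.injOn hk) (i := k - 1 + 1) (by omega)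
  rwa [antipodalSeq_succ (by omega), show k - 1 + 1 + 1 = 2 * k - (k - 1) by omega,
    antipodalSeq_sub (by omega)] at this

end AntipodalCycles

/-! ### Cycles of constant step -/

section StepCycles

/-- The vertex sequence `0, 2ε, 4ε, …` in part `0`. -/
def stepSeq (ℓ : ℕ) (ε : ℤ) (i : ℕ) : Vertex (2 * ℓ) := point (2 * ℓ) (2 * ε * i) 0

variable {ℓ k m : ℕ} {ε c : ℤ}

theorem stepSeq_injOn (hm : m * ε = 1 + c * ℓ) : Set.InjOn (stepSeq ℓ ε) (Set.Iio ℓ) := by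
  intro i hi j hj e
  have hi : i < ℓ := hi
  have hj : j < ℓ := hj
  obtain ⟨⟨d, hd⟩, -⟩ := point_eq_point_iff.1 e
  push_cast at hd
  have hd' : ε * (j - i) = ℓ * d := by linarith
  have h : (ℓ : ℤ) ∣ j - i := by
    refine ⟨m * d - c * (j - i), ?_⟩
    linear_combination m * hd' - (j - i : ℤ) * hm
  have := Int.eq_zero_of_abs_lt_dvd h (abs_lt.2 ⟨by omega, by omega⟩)
  omega

theorem stepSeq_mod (i : ℕ) : stepSeq ℓ ε (i % ℓ) = stepSeq ℓ ε i := by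
  refine point_eq_point_iff.2 ⟨⟨ε * (i / ℓ : ℕ), ?_⟩, Iff.rfl⟩
  have : (i : ℤ) = ℓ * (i / ℓ : ℕ) + (i % ℓ : ℕ) := by exact_mod_cast (Nat.div_add_mod i ℓ).symm
  push_cast at this ⊢
  linear_combination 2 * ε * this

theorem translateSubgraph_stepSeq (hm : m * ε = 1 + c * ℓ) :
    translateSubgraph ((2 : ℕ) : ZMod (2 * ℓ)) (cycleSubgraph ℓ (stepSeq ℓ ε)) =
      cycleSubgraph ℓ (stepSeq ℓ ε) := by
  rw [translateSubgraph_cycleSubgraph, ← cycleSubgraph_rotate (stepSeq ℓ ε) m]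
  congr 1
  funext i
  rw [stepSeq_mod, stepSeq, stepSeq, ← Int.cast_natCast (2 : ℕ), translate_point]
  refine point_eq_point_iff.2 ⟨⟨c, ?_⟩, Iff.rfl⟩
  push_cast
  linear_combination 2 * hm

/-- The vertices of the cycle `0, 2ε, 4ε, …` are all even elements of part `0`. -/
theorem image_stepSeq (hm : m * ε = 1 + c * ℓ) :
    (Finset.range ℓ).image (stepSeq ℓ ε) = (Finset.range ℓ).image (stepSeq ℓ 1) := by
  symm
  apply Finset.eq_of_subset_of_card_le
  · intro v hv
    obtain ⟨i, hi, rfl⟩ := Finset.mem_image.1 hv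
    have hi := Finset.mem_range.1 hi
    refine Finset.mem_image.2 ⟨(m * i) % ℓ, Finset.mem_range.2 (Nat.mod_lt _ (by omega)), ?_⟩
    rw [stepSeq_mod]
    refine point_eq_point_iff.2 ⟨⟨-(c * i), ?_⟩, Iff.rfl⟩
    push_cast
    linear_combination -2 * (i : ℤ) * hm
  · rw [Finset.card_image_of_injOn, Finset.card_image_of_injOn]
    · have := stepSeq_injOn (ℓ := ℓ) (ε := 1) (m := 1) (c := 0) (by ring)
      simpa using this
    · have := stepSeq_injOn hm
      simpa using this

theorem isEquitableColouring_stepSeq (hk : ℓ = 2 * k + 1) (hm : m * ε = 1 + c * ℓ) :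
    IsEquitableColouring ℓ
      (development (cycleSubgraph ℓ (stepSeq ℓ ε))) (colouring ℓ) := by
  have : NeZero (2 * ℓ) := ⟨by omega⟩
  rintro _ ⟨t, rfl⟩ s
  change Set.ncard {v | v ∈ (translateSubgraph t _).verts ∧ _} = _ ∨
    Set.ncard {v | v ∈ (translateSubgraph t _).verts ∧ _} = _
  rw [← translateSubgraph_val_mod (translateSubgraph_stepSeq hm) t, card_colour,
    ncard_colour_translateSubgraph, image_stepSeq hm, Finset.filter_image,
    Finset.card_image_of_injOn]
  swap
  · intro i hi j hj e
    have hi := (Finset.mem_filter.1 hi).1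
    have hj := (Finset.mem_filter.1 hj).1
    exact stepSeq_injOn (ℓ := ℓ) (ε := 1) (m := 1) (c := 0) (by ring)
      (Finset.mem_range.1 hi) (Finset.mem_range.1 hj) e
  -- Every translate is the one by `r = 0` or by `r = 1`.
  obtain ⟨r, hr⟩ : ∃ r, r = t.val % 2 := ⟨_, rfl⟩
  rw [← hr]
  have hr2 : r < 2 := by omega
  have hred : ∀ i < ℓ, (colouring ℓ (translate (r : ZMod (2 * ℓ)) (stepSeq ℓ 1 i)) = Colour.red ↔
      i < k + 1 - r) := by
    intro i hi
    have hval : ((((2 * 1 * i : ℤ) + r : ℤ) : ZMod (2 * ℓ))).val = 2 * i + r := by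
      rw [show ((2 * 1 * i : ℤ) + r) = ((2 * i + r : ℕ) : ℤ) by push_cast; ring, Int.cast_natCast]
      exact ZMod.val_cast_of_lt (by omega)
    rw [stepSeq, ← Int.cast_natCast r, translate_point]
    simp only [point, colouring, hval]
    split_ifs with h1 <;> simp at h1 ⊢ <;> omega
  have hcard : ((Finset.range ℓ).filter fun i =>
      colouring ℓ (translate (r : ZMod (2 * ℓ)) (stepSeq ℓ 1 i)) = Colour.red).card =
        k + 1 - r := by
    rw [show ((Finset.range ℓ).filter fun i => colouring ℓ
      (translate (r : ZMod (2 * ℓ)) (stepSeq ℓ 1 i)) = Colour.red) =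
        Finset.range (k + 1 - r) from ?_,
      Finset.card_range]
    ext i
    rw [Finset.mem_filter, Finset.mem_range, Finset.mem_range]
    constructor
    · rintro ⟨hi, h⟩
      exact (hred i hi).1 h
    · intro h
      exact ⟨by omega, (hred i (by omega)).2 h⟩
  have hadd := Finset.card_filter_add_card_filter_not (s := Finset.range ℓ)
    (fun i => colouring ℓ (translate (r : ZMod (2 * ℓ)) (stepSeq ℓ 1 i)) = Colour.red)
  rw [hcard, Finset.card_range] at hadd
  have hblue : ∀ d : Colour, ¬ d = Colour.red ↔ d = Colour.blue := by decide
  simp only [hblue] at hadd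
  have hceil : ℓ ⌈/⌉ 2 = k + 1 := by rw [hk, ceilDiv_two_odd]
  rw [hceil]
  cases s with
  | red => rw [hcard]; omega
  | blue => omega

theorem hasDiff_stepSeq (hℓ : 2 ≤ ℓ) (hm : m * ε = 1 + c * ℓ) :
    HasDiff (cycleSubgraph ℓ (stepSeq ℓ ε)) 0 0 ((2 * ε : ℤ) : ZMod (2 * ℓ)) := by
  have h := cycleSubgraph_adj_succ (stepSeq_injOn hm) (i := 0) (by omega)
  exact hasDiff_zero_zero h ⟨rfl, rfl, Or.inl (by push_cast; ring)⟩

end StepCycles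

/-! ### Base systems and their decompositions -/

section Assembly

theorem IsMatchedSeq.adj_succ {ℓ : ℕ} {x s : ℕ → ℤ} {i₀ : ℕ} (h : IsMatchedSeq ℓ x s i₀) (i : ℕ)
    (hi : i + 1 < ℓ) :
    (cycleSubgraph ℓ fun i => point (2 * ℓ) (x i) (s i)).Adj
      (point (2 * ℓ) (x i) (s i)) (point (2 * ℓ) (x (i + 1)) (s (i + 1))) :=
  cycleSubgraph_adj_succ h.injOn hi

theorem IsMatchedSeq.adj_last {ℓ : ℕ} {x s : ℕ → ℤ} {i₀ : ℕ} (h : IsMatchedSeq ℓ x s i₀)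
    (hℓ : 2 ≤ ℓ) :
    (cycleSubgraph ℓ fun i => point (2 * ℓ) (x i) (s i)).Adj
      (point (2 * ℓ) (x (ℓ - 1)) (s (ℓ - 1))) (point (2 * ℓ) (x 0) (s 0)) :=
  cycleSubgraph_adj_last hℓ h.injOn

/-- The six base cycles: three cycles of matched vertices, two antipodal cycles through `∞`, and
a cycle of constant step. -/
def baseSeq (ℓ k : ℕ) (x s : Fin 3 → ℕ → ℤ) (y u : Fin 2 → ℕ → ℤ) (ε : ℤ) :
    Fin 6 → ℕ → Vertex (2 * ℓ) :=
  ![fun i => point (2 * ℓ) (x 0 i) (s 0 i), fun i => point (2 * ℓ) (x 1 i) (s 1 i),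
    fun i => point (2 * ℓ) (x 2 i) (s 2 i), antipodalSeq ℓ k (y 0) (u 0),
    antipodalSeq ℓ k (y 1) (u 1), stepSeq ℓ ε]

/-- The properties of the vertex sequences of the base cycles that make their translates an
equitably coloured decomposition: apart from the shape of the individual cycles, every
difference has to occur in one of them. -/
structure IsBaseSystem (ℓ k : ℕ) (x s : Fin 3 → ℕ → ℤ) (y u : Fin 2 → ℕ → ℤ) (ε : ℤ) : Prop where
  /-- the first three cycles consist of pairs `a_0, a_1` and one further vertex -/
  matched : ∀ j, ∃ i₀, IsMatchedSeq ℓ (x j) (s j) i₀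
  /-- the next two cycles are antipodally symmetric cycles through `∞` -/
  antipodal : ∀ j, IsAntipodalTransversal ℓ k (y j) (u j)
  /-- `ε` is invertible modulo `ℓ`, so that the last cycle has length `ℓ` -/
  step : ∃ (m : ℕ) (c : ℤ), m * ε = 1 + c * ℓ
  /-- the neighbours of `∞` lie in both parts -/
  first : ∀ p : Fin 2, ∃ j, (if u j 0 = 0 then 0 else 1) = p
  /-- the edges of difference `ℓ` lie in both parts -/
  last : ∀ p : Fin 2, ∃ j, (if u j (k - 1) = 0 then 0 else 1) = p
  /-- the differences within part `0` -/
  pure_zero : ∀ d : ℤ, 1 ≤ d → d ≤ k →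
    (∃ i, HasDiff (cycleSubgraph ℓ (baseSeq ℓ k x s y u ε i)) 0 0 (d : ZMod (2 * ℓ))) ∧
    ∃ i, HasDiff (cycleSubgraph ℓ (baseSeq ℓ k x s y u ε i)) 0 0 ((ℓ - d : ℤ) : ZMod (2 * ℓ))
  /-- the differences within part `1` -/
  pure_one : ∀ d : ℤ, 1 ≤ d → d ≤ k →
    (∃ i, HasDiff (cycleSubgraph ℓ (baseSeq ℓ k x s y u ε i)) 1 1 (d : ZMod (2 * ℓ))) ∧
    ∃ i, HasDiff (cycleSubgraph ℓ (baseSeq ℓ k x s y u ε i)) 1 1 ((ℓ - d : ℤ) : ZMod (2 * ℓ))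
  /-- the differences from part `0` to part `1` -/
  mixed : ∀ d : ℤ, -k ≤ d → d ≤ k →
    (∃ i, HasDiff (cycleSubgraph ℓ (baseSeq ℓ k x s y u ε i)) 0 1 (d : ZMod (2 * ℓ))) ∧
    ∃ i, HasDiff (cycleSubgraph ℓ (baseSeq ℓ k x s y u ε i)) 0 1 ((ℓ + d : ℤ) : ZMod (2 * ℓ))

variable {ℓ k : ℕ} {x s : Fin 3 → ℕ → ℤ} {y u : Fin 2 → ℕ → ℤ} {ε : ℤ}

theorem IsBaseSystem.injOn (h : IsBaseSystem ℓ k x s y u ε) (hk : ℓ = 2 * k + 1) (i : Fin 6) :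
    Set.InjOn (baseSeq ℓ k x s y u ε i) (Set.Iio ℓ) := by
  obtain ⟨m, c, hm⟩ := h.step
  have hx : ∀ j, Set.InjOn (fun i => point (2 * ℓ) (x j i) (s j i)) (Set.Iio ℓ) := fun j =>
    (h.matched j).choose_spec.injOn
  fin_cases i
  exacts [hx 0, hx 1, hx 2, (h.antipodal 0).injOn hk, (h.antipodal 1).injOn hk, stepSeq_injOn hm]

theorem IsBaseSystem.translateSubgraph_eq (h : IsBaseSystem ℓ k x s y u ε) (hk : ℓ = 2 * k + 1)
    (i : Fin 6) :
    translateSubgraph ((![2 * ℓ, 2 * ℓ, 2 * ℓ, ℓ, ℓ, 2] i : ℕ) : ZMod (2 * ℓ))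
      (cycleSubgraph ℓ (baseSeq ℓ k x s y u ε i)) =
      cycleSubgraph ℓ (baseSeq ℓ k x s y u ε i) := by
  obtain ⟨m, c, hm⟩ := h.step
  have hfull : ∀ C : (completeGraph (Vertex (2 * ℓ))).Subgraph,
      translateSubgraph ((2 * ℓ : ℕ) : ZMod (2 * ℓ)) C = C := fun C => by
    rw [ZMod.natCast_self, translateSubgraph_zero]
  fin_cases i
  exacts [hfull _, hfull _, hfull _, translateSubgraph_antipodalSeq hk _ _,
    translateSubgraph_antipodalSeq hk _ _, translateSubgraph_stepSeq hm]

theorem IsBaseSystem.covers (h : IsBaseSystem ℓ k x s y u ε) (hk : ℓ = 2 * k + 1) (hk0 : 0 < k) :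
    ∀ e ∈ (completeGraph (Vertex (2 * ℓ))).edgeSet,
      ∃ i, ∃ C ∈ development (cycleSubgraph ℓ (baseSeq ℓ k x s y u ε i)), e ∈ C.edgeSet := by
  have hidx : ∀ (P : (ℕ → Vertex (2 * ℓ)) → Prop) (j : Fin 2),
      P (antipodalSeq ℓ k (y j) (u j)) → ∃ i, P (baseSeq ℓ k x s y u ε i) := by
    intro P j hj
    fin_cases j
    exacts [⟨3, hj⟩, ⟨4, hj⟩]
  refine covers_of_hasDiff hk _ (fun p d h1 h2 => ?_) (fun p => ?_) h.mixed fun p => ?_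
  · obtain rfl | rfl : p = 0 ∨ p = 1 := by omega
    exacts [h.pure_zero d h1 h2, h.pure_one d h1 h2]
  · obtain ⟨j, rfl⟩ := h.last p
    refine hidx (fun v => HasDiff (cycleSubgraph ℓ v) _ _ _) j ?_
    exact hasDiff_self_of_adj ((h.antipodal j).adj_half hk hk0) (by omega)
  · obtain ⟨j, rfl⟩ := h.first p
    refine hidx (fun v => ∃ a, (cycleSubgraph ℓ v).Adj none (some (a, _))) j ?_
    exact ⟨_, (h.antipodal j).adj_none hk hk0⟩

theorem IsBaseSystem.isEquitableColouring (h : IsBaseSystem ℓ k x s y u ε) (hk : ℓ = 2 * k + 1)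
    (i : Fin 6) : IsEquitableColouring ℓ
      (development (cycleSubgraph ℓ (baseSeq ℓ k x s y u ε i))) (colouring ℓ) := by
  obtain ⟨m, c, hm⟩ := h.step
  have hx := fun j => (h.matched j).choose_spec.isEquitableColouring hk
  fin_cases i
  exacts [hx 0, hx 1, hx 2, (h.antipodal 0).isEquitableColouring hk,
    (h.antipodal 1).isEquitableColouring hk, isEquitableColouring_stepSeq hk hm]

theorem IsBaseSystem.none_mem_verts_iff (hk : ℓ = 2 * k + 1) (i : Fin 6) :
    none ∈ (cycleSubgraph ℓ (baseSeq ℓ k x s y u ε i)).verts ↔ i = 3 ∨ i = 4 := by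
  have hx : ∀ a b : ℕ → ℤ,
      none ∉ (cycleSubgraph ℓ fun i => point (2 * ℓ) (a i) (b i)).verts := by
    rintro a b ⟨j, -, hj⟩
    exact point_ne_none _ _ hj
  have hy : ∀ a b, none ∈ (cycleSubgraph ℓ (antipodalSeq ℓ k a b)).verts := fun a b =>
    ⟨0, show 0 < ℓ by omega, rfl⟩
  fin_cases i
  exacts [iff_of_false (hx _ _) (by decide), iff_of_false (hx _ _) (by decide),
    iff_of_false (hx _ _) (by decide), iff_of_true (hy _ _) (by decide),
    iff_of_true (hy _ _) (by decide), iff_of_false (hx _ _) (by decide)]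

theorem IsBaseSystem.exists_decomposition (h : IsBaseSystem ℓ k x s y u ε) (hk : ℓ = 2 * k + 1)
    (hk0 : 0 < k) :
    ∃ (𝒞 : Set (completeGraph (Vertex (2 * ℓ))).Subgraph)
      (B : Fin 6 → (completeGraph (Vertex (2 * ℓ))).Subgraph),
      Nat.card (Vertex (2 * ℓ)) = 4 * ℓ + 1 ∧
      IsCycleDecomposition (completeGraph (Vertex (2 * ℓ))) ℓ 𝒞 ∧
      IsEquitableColouring ℓ 𝒞 (colouring ℓ) ∧
      {v | colouring ℓ v = Colour.red}.ncard = 2 * ℓ ∧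
      {v | colouring ℓ v = Colour.blue}.ncard = 2 * ℓ + 1 ∧
      IsTwoRotational (2 * ℓ) 𝒞 ∧
      (𝒞 = ⋃ i : Fin 6, development (B i)) ∧
      (∀ i : Fin 6, (development (B i)).ncard = ![2 * ℓ, 2 * ℓ, 2 * ℓ, ℓ, ℓ, 2] i) ∧
      (∀ i : Fin 6, none ∈ (B i).verts ↔ i = 3 ∨ i = 4) := by
  obtain ⟨hdec, hcard⟩ := isCycleDecomposition_of_cover (show 3 ≤ ℓ by omega)
    (baseSeq ℓ k x s y u ε) (h.injOn hk) (h.translateSubgraph_eq hk) (h.covers hk hk0)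
  obtain ⟨hred, hblue⟩ := ncard_colour_classes (show 0 < ℓ by omega)
  refine ⟨_, fun i => cycleSubgraph ℓ (baseSeq ℓ k x s y u ε i), ?_, hdec, ?_, hred, hblue,
    isTwoRotational_iUnion_development (by omega) _, rfl, hcard,
    IsBaseSystem.none_mem_verts_iff hk⟩
  · rw [card_vertex _ (by omega)]
    ring
  · intro C hC
    obtain ⟨i, hi⟩ := Set.mem_iUnion.1 hC
    exact h.isEquitableColouring hk i C hi

end Assembly

/-! ### The base cycles for lengths 4h + 1 -/

section Even

variable (h : ℕ)

/-- First coordinates of a cycle that alternates between the parts. Modulo `4h + 1` they are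
`0, 2h - 1, 1, 2h - 2, …, 2h - 1, 0` and, at the last vertex, `2h`. The summands `4h + 1` are
placed so that exactly one of two consecutive coordinates carries one, except in the middle and
next to the last vertex. -/
def evenX₀ (i : ℕ) : ℤ :=
  if i = 4 * h then 2 * h
  else if i % 2 = 0 then (if h ≤ i / 2 then (i / 2 : ℕ) + (4 * h + 1) else (i / 2 : ℕ))
  else (if i / 2 < h then 2 * h - 1 - (i / 2 : ℕ) + (4 * h + 1) else 2 * h - 1 - (i / 2 : ℕ))

/-- First coordinates of a cycle that consists of the inward zigzag `0, 2h, 1, 2h - 1, …, h` in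
part `0` and the outward zigzag `h - 1, h, h - 2, h + 1, …, 0, 2h - 1` in part `1`. -/
def evenX₁ (i : ℕ) : ℤ :=
  if i ≤ 2 * h then (if i % 2 = 0 then (i / 2 : ℕ) else 2 * h - (i / 2 : ℕ))
  else (if i % 2 = 0 then (i / 2 : ℕ) - 1 else 2 * h - 1 - (i / 2 : ℕ))

/-- First coordinates of a cycle that consists of the inward zigzag `0, 2h, 1, 2h - 1, …, h` in
part `1` and the outward zigzag `h - 1, h + 1, …, 0, 2h` in part `0`, where `4h + 1` is added to
all coordinates above `h`, so that the differences within the parts increase by `4h + 1`. -/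
def evenX₂ (i : ℕ) : ℤ :=
  if i ≤ 2 * h then (if i % 2 = 0 then (i / 2 : ℕ) else 2 * h - (i / 2 : ℕ) + (4 * h + 1))
  else (if i % 2 = 0 then (i / 2 : ℕ) + (4 * h + 1) else 2 * h - 1 - (i / 2 : ℕ))

/-- The parts `a, b, a, b, …`. -/
def alternating (a b : ℤ) (i : ℕ) : ℤ := if i % 2 = 0 then a else b

/-- The parts `a` for the vertices with indices `0, …, m`, and `b` for the later ones. -/
def switching (m : ℕ) (a b : ℤ) (i : ℕ) : ℤ := if i ≤ m then a else b

/-- First coordinates, in alternating parts, of the outward zigzag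
`h + 1, h - 1, h + 2, h - 2, …, 2h, 0`. -/
def evenY₀ (i : ℕ) : ℤ := if i % 2 = 0 then h + 1 + (i / 2 : ℕ) else h - 1 - (i / 2 : ℕ)

/-- First coordinates, in alternating parts, of the inward zigzag
`2h, 0, 2h - 2, 1, 2h - 3, …, h - 2, h, h`, where `4h + 1` is added to the first and the last
of them. -/
def evenY₁ (i : ℕ) : ℤ :=
  if i = 0 then 2 * h + (4 * h + 1) else if i + 1 = 2 * h then h + (4 * h + 1)
  else if i % 2 = 0 then 2 * h - 1 - (i / 2 : ℕ) else (i / 2 : ℕ)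

variable {h}

theorem isMatchedSeq_even₀ (hh : 2 ≤ h) :
    IsMatchedSeq (4 * h + 1) (evenX₀ h) (alternating 1 0) (4 * h) where
  lt := by omega
  part i _ := by unfold alternating; split_ifs <;> omega
  ne i j hij hj := by
    unfold alternating evenX₀
    split_ifs <;> omega
  matching i hi hne := by
    refine ⟨4 * h - 1 - i, by omega, by omega, ?_, ?_⟩
    · unfold evenX₀; split_ifs <;> omega
    · unfold alternating; split_ifs <;> omega

theorem isMatchedSeq_even₁ (hh : 2 ≤ h) :
    IsMatchedSeq (4 * h + 1) (evenX₁ h) (switching (2 * h) 0 1) 1 where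
  lt := by omega
  part i _ := by unfold switching; split_ifs <;> omega
  ne i j hij hj := by
    unfold switching evenX₁
    split_ifs <;> omega
  matching i hi hne := by
    -- The index at which the other zigzag takes the value at `i`.
    refine ⟨if i = 2 * h then 2 * h + 2 else if i = 2 * h + 2 then 2 * h
      else if (i ≤ 2 * h ↔ i % 2 = 0) then 4 * h - 1 - i else 4 * h + 3 - i, ?_, ?_, ?_, ?_⟩
    · split_ifs <;> omega
    · split_ifs <;> omega
    · unfold evenX₁; split_ifs <;> omega
    · unfold switching; split_ifs <;> omega

theorem isMatchedSeq_even₂ (hh : 2 ≤ h) :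
    IsMatchedSeq (4 * h + 1) (evenX₂ h) (switching (2 * h) 1 0) (2 * h) where
  lt := by omega
  part i _ := by unfold switching; split_ifs <;> omega
  ne i j hij hj := by
    unfold switching evenX₂
    split_ifs <;> omega
  matching i hi hne := by
    -- The index at which the other zigzag takes the value at `i`.
    refine ⟨if (i < 2 * h ↔ i % 2 = 0) then 4 * h - 1 - i else 4 * h + 1 - i, ?_, ?_, ?_, ?_⟩
    · split_ifs <;> omega
    · split_ifs <;> omega
    · unfold evenX₂; split_ifs <;> omega
    · unfold switching; split_ifs <;> omega

theorem isAntipodalTransversal_even₀ (hh : 2 ≤ h) :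
    IsAntipodalTransversal (4 * h + 1) (2 * h) (evenY₀ h) (alternating 0 1) := by
  intro i j hij hj
  unfold alternating evenY₀
  split_ifs <;> omega

theorem isAntipodalTransversal_even₁ (hh : 2 ≤ h) :
    IsAntipodalTransversal (4 * h + 1) (2 * h) (evenY₁ h) (alternating 1 0) := by
  intro i j hij hj
  unfold alternating evenY₁
  split_ifs <;> omega

/-- The six base cycles in the case `ℓ = 4h + 1`, `k = 2h`.

Pure differences `d` occur in `evenX₁`, and pure differences `ℓ - d` in `evenX₂`. The exceptions
are the difference `k` in part `1`, on the closing edge of `evenX₀`, and the difference `ℓ - 1` in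
part `0`, in the cycle of constant step. Mixed differences `ℓ + d` occur in `evenX₀`, and mixed
differences `d` in `evenY₀` if they are negative and in `evenY₁` if they are positive. The mixed
differences which this leaves open occur on single edges: those of `evenX₁` and `evenX₂` that join
the two parts, the middle edge of `evenX₀` and the one before its closing edge, and the first and
last edge of the zigzag `evenY₁`. -/
def evenBase (h : ℕ) : Fin 6 → ℕ → Vertex (2 * (4 * h + 1)) :=
  baseSeq (4 * h + 1) (2 * h) ![evenX₀ h, evenX₁ h, evenX₂ h]
    ![alternating 1 0, switching (2 * h) 0 1, switching (2 * h) 1 0] ![evenY₀ h, evenY₁ h]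
    ![alternating 0 1, alternating 1 0] (2 * h)

theorem hasDiff_evenBase_zero_zero (hh : 2 ≤ h) {d : ℤ} (h1 : 1 ≤ d) (h2 : d ≤ 2 * h) :
    ∃ i, HasDiff (cycleSubgraph (4 * h + 1) (evenBase h i)) 0 0 (d : ZMod (2 * (4 * h + 1))) := by
  obtain ⟨i, hi⟩ : ∃ i : ℕ, (i : ℤ) = 2 * h - d := ⟨(2 * h - d).toNat, by omega⟩
  exact ⟨1, hasDiff_zero_zero ((isMatchedSeq_even₁ hh).adj_succ i (by omega)) (by
    unfold switching evenX₁; split_ifs <;> omega)⟩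

theorem hasDiff_evenBase_zero_zero_sub (hh : 2 ≤ h) {d : ℤ} (h1 : 1 ≤ d) (h2 : d ≤ 2 * h) :
    ∃ i, HasDiff (cycleSubgraph (4 * h + 1) (evenBase h i)) 0 0
      ((((4 * h + 1 : ℕ) : ℤ) - d : ℤ) : ZMod (2 * (4 * h + 1))) := by
  rcases eq_or_lt_of_le h1 with rfl | h1
  · -- the constant step is `2 * (2 * h) = ℓ - 1`
    have := hasDiff_stepSeq (ℓ := 4 * h + 1) (ε := 2 * h) (m := 4 * h - 1) (c := 2 * h - 1)
      (by omega) (by rw [Nat.cast_sub (by omega)]; push_cast; ring)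
    refine ⟨5, ?_⟩
    rwa [show (2 * (2 * h) : ℤ) = ((4 * h + 1 : ℕ) : ℤ) - 1 by push_cast; ring] at this
  · obtain ⟨i, hi⟩ : ∃ i : ℕ, (i : ℤ) = 2 * h - 1 + d := ⟨(2 * h - 1 + d).toNat, by omega⟩
    exact ⟨2, hasDiff_zero_zero ((isMatchedSeq_even₂ hh).adj_succ i (by omega)) (by
      unfold switching evenX₂; split_ifs <;> omega)⟩

theorem hasDiff_evenBase_one_one (hh : 2 ≤ h) {d : ℤ} (h1 : 1 ≤ d) (h2 : d ≤ 2 * h) :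
    ∃ i, HasDiff (cycleSubgraph (4 * h + 1) (evenBase h i)) 1 1 (d : ZMod (2 * (4 * h + 1))) := by
  rcases eq_or_lt_of_le h2 with rfl | h2
  · exact ⟨0, hasDiff_one_one ((isMatchedSeq_even₀ hh).adj_last (by omega)) (by
      unfold alternating evenX₀; split_ifs <;> omega)⟩
  · obtain ⟨i, hi⟩ : ∃ i : ℕ, (i : ℤ) = 2 * h + d := ⟨(2 * h + d).toNat, by omega⟩
    exact ⟨1, hasDiff_one_one ((isMatchedSeq_even₁ hh).adj_succ i (by omega)) (by
      unfold switching evenX₁; split_ifs <;> omega)⟩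

theorem hasDiff_evenBase_one_one_sub (hh : 2 ≤ h) {d : ℤ} (h1 : 1 ≤ d) (h2 : d ≤ 2 * h) :
    ∃ i, HasDiff (cycleSubgraph (4 * h + 1) (evenBase h i)) 1 1
      ((((4 * h + 1 : ℕ) : ℤ) - d : ℤ) : ZMod (2 * (4 * h + 1))) := by
  obtain ⟨i, hi⟩ : ∃ i : ℕ, (i : ℤ) = 2 * h - d := ⟨(2 * h - d).toNat, by omega⟩
  exact ⟨2, hasDiff_one_one ((isMatchedSeq_even₂ hh).adj_succ i (by omega)) (by
    unfold switching evenX₂; split_ifs <;> omega)⟩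

theorem hasDiff_evenBase_zero_one (hh : 2 ≤ h) {d : ℤ} (h1 : -(2 * h) ≤ d) (h2 : d ≤ 2 * h) :
    ∃ i, HasDiff (cycleSubgraph (4 * h + 1) (evenBase h i)) 0 1 (d : ZMod (2 * (4 * h + 1))) := by
  rcases le_or_gt d (-2) with h3 | h3
  · obtain ⟨i, hi⟩ : ∃ i : ℕ, (i : ℤ) = -2 - d := ⟨(-2 - d).toNat, by omega⟩
    exact ⟨3, hasDiff_zero_one
      ((isAntipodalTransversal_even₀ hh).adj_succ (by ring) i (by omega)) (by
      unfold alternating evenY₀; split_ifs <;> omega)⟩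
  obtain rfl | rfl | rfl | rfl | rfl | ⟨h4, h5⟩ : d = -1 ∨ d = 0 ∨ d = 1 ∨ d = 2 * h - 1 ∨
    d = 2 * h ∨ (2 ≤ d ∧ d ≤ 2 * h - 2) := by omega
  · exact ⟨1, hasDiff_zero_one ((isMatchedSeq_even₁ hh).adj_succ (2 * h) (by omega)) (by
      unfold switching evenX₁; split_ifs <;> omega)⟩
  · exact ⟨0, hasDiff_zero_one ((isMatchedSeq_even₀ hh).adj_succ (2 * h - 1) (by omega)) (by
      unfold alternating evenX₀; split_ifs <;> omega)⟩
  · exact ⟨2, hasDiff_zero_one ((isMatchedSeq_even₂ hh).adj_succ (2 * h) (by omega)) (by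
      unfold switching evenX₂; split_ifs <;> omega)⟩
  · exact ⟨1, hasDiff_zero_one ((isMatchedSeq_even₁ hh).adj_last (by omega)) (by
      unfold switching evenX₁; split_ifs <;> omega)⟩
  · exact ⟨0, hasDiff_zero_one ((isMatchedSeq_even₀ hh).adj_succ (4 * h - 1) (by omega)) (by
      unfold alternating evenX₀; split_ifs <;> omega)⟩
  -- `contradiction` is for the hypotheses `False` that `split_ifs` leaves and `omega` ignores.
  · obtain ⟨i, hi⟩ : ∃ i : ℕ, (i : ℤ) = 2 * h - 1 - d := ⟨(2 * h - 1 - d).toNat, by omega⟩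
    exact ⟨4, hasDiff_zero_one
      ((isAntipodalTransversal_even₁ hh).adj_succ (by ring) i (by omega)) (by
      unfold alternating evenY₁; split_ifs <;> first | omega | contradiction)⟩

theorem hasDiff_evenBase_zero_one_add (hh : 2 ≤ h) {d : ℤ} (h1 : -(2 * h) ≤ d) (h2 : d ≤ 2 * h) :
    ∃ i, HasDiff (cycleSubgraph (4 * h + 1) (evenBase h i)) 0 1
      ((((4 * h + 1 : ℕ) : ℤ) + d : ℤ) : ZMod (2 * (4 * h + 1))) := by
  obtain rfl | rfl | rfl | ⟨h3, h4, h5⟩ : d = 0 ∨ d = -(2 * h) ∨ d = 2 * h ∨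
    (d ≠ 0 ∧ -(2 * h) < d ∧ d < 2 * h) := by omega
  · exact ⟨4, hasDiff_zero_one
      ((isAntipodalTransversal_even₁ hh).adj_succ (by ring) (2 * h - 2) (by omega)) (by
      unfold alternating evenY₁; split_ifs <;> first | omega | contradiction)⟩
  · exact ⟨2, hasDiff_zero_one ((isMatchedSeq_even₂ hh).adj_last (by omega)) (by
      unfold switching evenX₂; split_ifs <;> omega)⟩
  · exact ⟨4, hasDiff_zero_one
      ((isAntipodalTransversal_even₁ hh).adj_succ (by ring) 0 (by omega)) (by
      unfold alternating evenY₁; split_ifs <;> first | omega | contradiction)⟩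
  · obtain ⟨i, hi⟩ : ∃ i : ℕ, (i : ℤ) = d + 2 * h - 1 := ⟨(d + 2 * h - 1).toNat, by omega⟩
    exact ⟨0, hasDiff_zero_one ((isMatchedSeq_even₀ hh).adj_succ i (by omega)) (by
      unfold alternating evenX₀; split_ifs <;> omega)⟩

theorem isBaseSystem_even (hh : 2 ≤ h) :
    IsBaseSystem (4 * h + 1) (2 * h) ![evenX₀ h, evenX₁ h, evenX₂ h]
      ![alternating 1 0, switching (2 * h) 0 1, switching (2 * h) 1 0] ![evenY₀ h, evenY₁ h]
      ![alternating 0 1, alternating 1 0] (2 * h) where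
  matched j := by
    fin_cases j
    exacts [⟨_, isMatchedSeq_even₀ hh⟩, ⟨_, isMatchedSeq_even₁ hh⟩, ⟨_, isMatchedSeq_even₂ hh⟩]
  antipodal j := by
    fin_cases j
    exacts [isAntipodalTransversal_even₀ hh, isAntipodalTransversal_even₁ hh]
  step := by
    obtain ⟨m, hm⟩ : ∃ m : ℕ, (m : ℤ) = 4 * h - 1 := ⟨4 * h - 1, by omega⟩
    refine ⟨m, 2 * h - 1, ?_⟩
    rw [hm]
    push_cast
    ring
  first p := by
    obtain rfl | rfl : p = 0 ∨ p = 1 := by omega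
    exacts [⟨0, rfl⟩, ⟨1, rfl⟩]
  last p := by
    have hodd : (2 * h - 1) % 2 ≠ 0 := by omega
    obtain rfl | rfl : p = 0 ∨ p = 1 := by omega
    · exact ⟨1, by simp [alternating, hodd]⟩
    · exact ⟨0, by simp [alternating, hodd]⟩
  pure_zero d h1 h2 := by
    push_cast at h2
    exact ⟨hasDiff_evenBase_zero_zero hh h1 h2, hasDiff_evenBase_zero_zero_sub hh h1 h2⟩
  pure_one d h1 h2 := by
    push_cast at h2
    exact ⟨hasDiff_evenBase_one_one hh h1 h2, hasDiff_evenBase_one_one_sub hh h1 h2⟩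
  mixed d h1 h2 := by
    push_cast at h1 h2
    exact ⟨hasDiff_evenBase_zero_one hh h1 h2, hasDiff_evenBase_zero_one_add hh h1 h2⟩

end Even

/-! ### The base cycles for lengths 4h + 3 -/

section Odd

variable (h : ℕ)

/-- First coordinates of a cycle that alternates between the parts: the zigzag
`0, 2h, 1, 2h - 1, …, h, h, …, 2h, 0`, followed by the vertex `6h + 4`. -/
def oddX₀ (i : ℕ) : ℤ :=
  if i = 4 * h + 2 then 6 * h + 4 else if i % 2 = 0 then (i / 2 : ℕ) else 2 * h - (i / 2 : ℕ)

/-- The index `i` for `i ≤ 2h + 1`, and `i - (2h + 1)` for larger `i`: vertices whose indices have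
the same image will have the same first coordinate. -/
def oddFold (i : ℕ) : ℕ := if i ≤ 2 * h + 1 then i else i - (2 * h + 1)

/-- First coordinates of a cycle that consists of the zigzag `0, 2h + 1, 1, 2h, …, h, 5h + 4` in
part `1`, and of the same coordinates without the initial `0` in part `0`. -/
def oddX₁ (i : ℕ) : ℤ :=
  if oddFold h i = 2 * h + 1 then 5 * h + 4
  else if oddFold h i % 2 = 0 then (oddFold h i / 2 : ℕ)
  else 2 * h + 1 - (oddFold h i / 2 : ℕ)

/-- The coordinates `oddX₁` with the summand `4h + 3` at the values `1, …, h`; the parts are to be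
exchanged as well. -/
def oddX₂ (i : ℕ) : ℤ :=
  if oddFold h i = 2 * h + 1 then 5 * h + 4
  else if oddFold h i = 0 then 0
  else if oddFold h i % 2 = 0 then (oddFold h i / 2 : ℕ) + (4 * h + 3)
  else 2 * h + 1 - (oddFold h i / 2 : ℕ)

/-- First coordinates, in alternating parts, of the zigzag which modulo `4h + 3` consists of
`-(2h + 2)` followed by `0, 1 - h, -1, 2 - h, -2, …`. -/
def oddY₀ (i : ℕ) : ℤ :=
  if i = 0 then -(2 * h + 2) else if i % 2 = 0 then (i / 2 : ℕ) - h
  else 4 * h + 3 - (i / 2 : ℕ)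

/-- First coordinates, in alternating parts, of the inward zigzag `3h + 1, 0, 3h, 1, …`, where
`4h + 3` is added to every second vertex from index `h + 2` on, so that the differences increase
by `4h + 3` from there on. -/
def oddY₁ (i : ℕ) : ℤ :=
  (if i % 2 = 0 then 3 * h + 1 - (i / 2 : ℕ) else (i / 2 : ℕ)) +
    if h + 1 < i ∧ (i + h) % 2 = 0 then 4 * h + 3 else 0

variable {h}

theorem isMatchedSeq_odd₀ : IsMatchedSeq (4 * h + 3) (oddX₀ h) (alternating 1 0) (4 * h + 2) where
  lt := by omega
  part i _ := by unfold alternating; split_ifs <;> omega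
  ne i j hij hj := by
    unfold alternating oddX₀
    split_ifs <;> omega
  matching i hi hne := by
    refine ⟨4 * h + 1 - i, by omega, by omega, ?_, ?_⟩
    · unfold oddX₀; split_ifs <;> omega
    · unfold alternating; split_ifs <;> omega

theorem isMatchedSeq_odd₁ :
    IsMatchedSeq (4 * h + 3) (oddX₁ h) (switching (2 * h + 1) 1 0) 0 where
  lt := by omega
  part i _ := by unfold switching; split_ifs <;> omega
  ne i j hij hj := by
    unfold switching oddX₁ oddFold
    split_ifs <;> omega
  matching i hi hne := by
    refine ⟨if i ≤ 2 * h + 1 then i + (2 * h + 1) else i - (2 * h + 1), ?_, ?_, ?_, ?_⟩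
    · split_ifs <;> omega
    · split_ifs <;> omega
    · unfold oddX₁ oddFold; split_ifs <;> omega
    · unfold switching; split_ifs <;> omega

theorem isMatchedSeq_odd₂ :
    IsMatchedSeq (4 * h + 3) (oddX₂ h) (switching (2 * h + 1) 0 1) 0 where
  lt := by omega
  part i _ := by unfold switching; split_ifs <;> omega
  ne i j hij hj := by
    unfold switching oddX₂ oddFold
    split_ifs <;> omega
  matching i hi hne := by
    refine ⟨if i ≤ 2 * h + 1 then i + (2 * h + 1) else i - (2 * h + 1), ?_, ?_, ?_, ?_⟩
    · split_ifs <;> omega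
    · split_ifs <;> omega
    · unfold oddX₂ oddFold; split_ifs <;> omega
    · unfold switching; split_ifs <;> omega

theorem isAntipodalTransversal_odd₀ :
    IsAntipodalTransversal (4 * h + 3) (2 * h + 1) (oddY₀ h) (alternating 0 1) := by
  intro i j hij hj
  unfold alternating oddY₀
  split_ifs <;> omega

theorem isAntipodalTransversal_odd₁ :
    IsAntipodalTransversal (4 * h + 3) (2 * h + 1) (oddY₁ h) (alternating 1 0) := by
  intro i j hij hj
  unfold alternating oddY₁
  split_ifs <;> omega

/-- The six base cycles in the case `ℓ = 4h + 3`, `k = 2h + 1`.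

The pure differences other than `ℓ - k` in part `1`, on the closing edge of `oddX₀`, and `ℓ - k` in
part `0`, in the cycle of constant step, occur in `oddX₁` and `oddX₂`. Mixed differences `d` with
`|d| < k` occur in `oddX₀`, and mixed differences `ℓ + d` in `oddY₀` if `|d| < h` and in `oddY₁` if
`|d| > h + 1`. The remaining mixed differences occur on single edges; among these, `ℓ + d` with
`|d| = h` or `|d| = h + 1` belong to the edges of `oddX₁` and `oddX₂` that join the two parts. -/
def oddBase (h : ℕ) : Fin 6 → ℕ → Vertex (2 * (4 * h + 3)) :=
  baseSeq (4 * h + 3) (2 * h + 1) ![oddX₀ h, oddX₁ h, oddX₂ h]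
    ![alternating 1 0, switching (2 * h + 1) 1 0, switching (2 * h + 1) 0 1]
    ![oddY₀ h, oddY₁ h] ![alternating 0 1, alternating 1 0] (h + 1)

theorem hasDiff_oddBase_zero_zero (hh : 1 ≤ h) {d : ℤ} (h1 : 1 ≤ d) (h2 : d ≤ 2 * h + 1) :
    ∃ i, HasDiff (cycleSubgraph (4 * h + 3) (oddBase h i)) 0 0
      (d : ZMod (2 * (4 * h + 3))) := by
  obtain rfl | rfl | ⟨h3, h4⟩ : d = 1 ∨ d = 2 * h + 1 ∨ (2 ≤ d ∧ d ≤ 2 * h) := by omega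
  · exact ⟨2, hasDiff_zero_zero (isMatchedSeq_odd₂.adj_succ (2 * h) (by omega)) (by
      unfold switching oddX₂ oddFold; split_ifs <;> omega)⟩
  · exact ⟨2, hasDiff_zero_zero (isMatchedSeq_odd₂.adj_succ 0 (by omega)) (by
      unfold switching oddX₂ oddFold; split_ifs <;> first | omega | contradiction)⟩
  · obtain ⟨i, hi⟩ : ∃ i : ℕ, (i : ℤ) = 4 * h + 2 - d := ⟨(4 * h + 2 - d).toNat, by omega⟩
    exact ⟨1, hasDiff_zero_zero (isMatchedSeq_odd₁.adj_succ i (by omega)) (by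
      unfold switching oddX₁ oddFold; split_ifs <;> omega)⟩

theorem hasDiff_oddBase_zero_zero_sub (hh : 1 ≤ h) {d : ℤ} (h1 : 1 ≤ d) (h2 : d ≤ 2 * h + 1) :
    ∃ i, HasDiff (cycleSubgraph (4 * h + 3) (oddBase h i)) 0 0
      ((((4 * h + 3 : ℕ) : ℤ) - d : ℤ) : ZMod (2 * (4 * h + 3))) := by
  obtain rfl | rfl | ⟨h3, h4⟩ : d = 1 ∨ d = 2 * h + 1 ∨ (2 ≤ d ∧ d ≤ 2 * h) := by omega
  · exact ⟨1, hasDiff_zero_zero (isMatchedSeq_odd₁.adj_succ (4 * h + 1) (by omega)) (by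
      unfold switching oddX₁ oddFold; split_ifs <;> omega)⟩
  · -- the constant step is `2 * (h + 1) = ℓ - (2 * h + 1)`
    have := hasDiff_stepSeq (ℓ := 4 * h + 3) (ε := h + 1) (m := 4) (c := 1) (by omega)
      (by push_cast; ring)
    refine ⟨5, ?_⟩
    rwa [show (2 * (h + 1) : ℤ) = ((4 * h + 3 : ℕ) : ℤ) - (2 * h + 1) by push_cast; ring] at this
  · obtain ⟨i, hi⟩ : ∃ i : ℕ, (i : ℤ) = 2 * h + 1 - d := ⟨(2 * h + 1 - d).toNat, by omega⟩
    exact ⟨2, hasDiff_zero_zero (isMatchedSeq_odd₂.adj_succ i (by omega)) (by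
      unfold switching oddX₂ oddFold; split_ifs <;> first | omega | contradiction)⟩

theorem hasDiff_oddBase_one_one (hh : 1 ≤ h) {d : ℤ} (h1 : 1 ≤ d) (h2 : d ≤ 2 * h + 1) :
    ∃ i, HasDiff (cycleSubgraph (4 * h + 3) (oddBase h i)) 1 1
      (d : ZMod (2 * (4 * h + 3))) := by
  obtain rfl | h3 : d = 1 ∨ 2 ≤ d := by omega
  · exact ⟨2, hasDiff_one_one (isMatchedSeq_odd₂.adj_succ (4 * h + 1) (by omega)) (by
      unfold switching oddX₂ oddFold; split_ifs <;> omega)⟩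
  · obtain ⟨i, hi⟩ : ∃ i : ℕ, (i : ℤ) = 2 * h + 1 - d := ⟨(2 * h + 1 - d).toNat, by omega⟩
    exact ⟨1, hasDiff_one_one (isMatchedSeq_odd₁.adj_succ i (by omega)) (by
      unfold switching oddX₁ oddFold; split_ifs <;> omega)⟩

theorem hasDiff_oddBase_one_one_sub (hh : 1 ≤ h) {d : ℤ} (h1 : 1 ≤ d) (h2 : d ≤ 2 * h + 1) :
    ∃ i, HasDiff (cycleSubgraph (4 * h + 3) (oddBase h i)) 1 1
      ((((4 * h + 3 : ℕ) : ℤ) - d : ℤ) : ZMod (2 * (4 * h + 3))) := by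
  obtain rfl | rfl | ⟨h3, h4⟩ : d = 1 ∨ d = 2 * h + 1 ∨ (2 ≤ d ∧ d ≤ 2 * h) := by omega
  · exact ⟨1, hasDiff_one_one (isMatchedSeq_odd₁.adj_succ (2 * h) (by omega)) (by
      unfold switching oddX₁ oddFold; split_ifs <;> omega)⟩
  · exact ⟨0, hasDiff_one_one (isMatchedSeq_odd₀.adj_last (by omega)) (by
      unfold alternating oddX₀; split_ifs <;> first | omega | contradiction)⟩
  · obtain ⟨i, hi⟩ : ∃ i : ℕ, (i : ℤ) = 4 * h + 2 - d := ⟨(4 * h + 2 - d).toNat, by omega⟩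
    exact ⟨2, hasDiff_one_one (isMatchedSeq_odd₂.adj_succ i (by omega)) (by
      unfold switching oddX₂ oddFold; split_ifs <;> omega)⟩

theorem hasDiff_oddBase_zero_one (hh : 1 ≤ h) {d : ℤ} (h1 : -(2 * h + 1) ≤ d)
    (h2 : d ≤ 2 * h + 1) :
    ∃ i, HasDiff (cycleSubgraph (4 * h + 3) (oddBase h i)) 0 1
      (d : ZMod (2 * (4 * h + 3))) := by
  obtain rfl | rfl | ⟨h3, h4⟩ : d = -(2 * h + 1) ∨ d = 2 * h + 1 ∨ (-(2 * h) ≤ d ∧ d ≤ 2 * h) := by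
    omega
  · exact ⟨3, hasDiff_zero_one (isAntipodalTransversal_odd₀.adj_succ (by ring) 0 (by omega)) (by
      unfold alternating oddY₀; split_ifs <;> first | omega | contradiction)⟩
  · exact ⟨4, hasDiff_zero_one (isAntipodalTransversal_odd₁.adj_succ (by ring) h (by omega)) (by
      unfold alternating oddY₁; split_ifs <;> omega)⟩
  · obtain ⟨i, hi⟩ : ∃ i : ℕ, (i : ℤ) = d + 2 * h := ⟨(d + 2 * h).toNat, by omega⟩
    exact ⟨0, hasDiff_zero_one (isMatchedSeq_odd₀.adj_succ i (by omega)) (by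
      unfold alternating oddX₀; split_ifs <;> omega)⟩

theorem hasDiff_oddBase_zero_one_add_of_abs_lt (hh : 1 ≤ h) {d : ℤ} (h1 : -h < d) (h2 : d < h) :
    ∃ i, HasDiff (cycleSubgraph (4 * h + 3) (oddBase h i)) 0 1
      ((((4 * h + 3 : ℕ) : ℤ) + d : ℤ) : ZMod (2 * (4 * h + 3))) := by
  obtain ⟨i, hi⟩ : ∃ i : ℕ, (i : ℤ) = h - d := ⟨(h - d).toNat, by omega⟩
  exact ⟨3, hasDiff_zero_one (isAntipodalTransversal_odd₀.adj_succ (by ring) i (by omega)) (by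
    unfold alternating oddY₀; split_ifs <;> first | omega | contradiction)⟩

theorem hasDiff_oddBase_zero_one_add_of_large (hh : 1 ≤ h) {d : ℤ} (h1 : h + 2 ≤ d)
    (h2 : d ≤ 2 * h) :
    ∃ i, HasDiff (cycleSubgraph (4 * h + 3) (oddBase h i)) 0 1
      ((((4 * h + 3 : ℕ) : ℤ) + d : ℤ) : ZMod (2 * (4 * h + 3))) := by
  obtain ⟨i, hi⟩ : ∃ i : ℕ, (i : ℤ) = 3 * h + 1 - d := ⟨(3 * h + 1 - d).toNat, by omega⟩
  exact ⟨4, hasDiff_zero_one (isAntipodalTransversal_odd₁.adj_succ (by ring) i (by omega)) (by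
    unfold alternating oddY₁; split_ifs <;> omega)⟩

theorem hasDiff_oddBase_zero_one_add_of_small (hh : 1 ≤ h) {d : ℤ} (h1 : -(2 * h + 1) ≤ d)
    (h2 : d ≤ -(h + 2)) :
    ∃ i, HasDiff (cycleSubgraph (4 * h + 3) (oddBase h i)) 0 1
      ((((4 * h + 3 : ℕ) : ℤ) + d : ℤ) : ZMod (2 * (4 * h + 3))) := by
  obtain ⟨i, hi⟩ : ∃ i : ℕ, (i : ℤ) = -h - 2 - d := ⟨(-h - 2 - d).toNat, by omega⟩
  exact ⟨4, hasDiff_zero_one (isAntipodalTransversal_odd₁.adj_succ (by ring) i (by omega)) (by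
    unfold alternating oddY₁; split_ifs <;> omega)⟩

theorem hasDiff_oddBase_zero_one_add (hh : 1 ≤ h) {d : ℤ} (h1 : -(2 * h + 1) ≤ d)
    (h2 : d ≤ 2 * h + 1) :
    ∃ i, HasDiff (cycleSubgraph (4 * h + 3) (oddBase h i)) 0 1
      ((((4 * h + 3 : ℕ) : ℤ) + d : ℤ) : ZMod (2 * (4 * h + 3))) := by
  obtain rfl | rfl | rfl | rfl | rfl | ⟨h3, h4⟩ | ⟨h3, h4⟩ | h3 : d = 2 * h + 1 ∨ d = -h ∨
    d = -(h + 1) ∨ d = h ∨ d = h + 1 ∨ (-h < d ∧ d < h) ∨ (h + 2 ≤ d ∧ d ≤ 2 * h) ∨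
    d ≤ -(h + 2) := by omega
  · exact ⟨0, hasDiff_zero_one (isMatchedSeq_odd₀.adj_succ (4 * h + 1) (by omega)) (by
      unfold alternating oddX₀; split_ifs <;> omega)⟩
  · exact ⟨1, hasDiff_zero_one (isMatchedSeq_odd₁.adj_succ (2 * h + 1) (by omega)) (by
      unfold switching oddX₁ oddFold; split_ifs <;> omega)⟩
  · exact ⟨1, hasDiff_zero_one (isMatchedSeq_odd₁.adj_last (by omega)) (by
      unfold switching oddX₁ oddFold; split_ifs <;> first | omega | contradiction)⟩
  · exact ⟨2, hasDiff_zero_one (isMatchedSeq_odd₂.adj_succ (2 * h + 1) (by omega)) (by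
      unfold switching oddX₂ oddFold; split_ifs <;> omega)⟩
  · exact ⟨2, hasDiff_zero_one (isMatchedSeq_odd₂.adj_last (by omega)) (by
      unfold switching oddX₂ oddFold; split_ifs <;> first | omega | contradiction)⟩
  · exact hasDiff_oddBase_zero_one_add_of_abs_lt hh h3 h4
  · exact hasDiff_oddBase_zero_one_add_of_large hh h3 h4
  · exact hasDiff_oddBase_zero_one_add_of_small hh h1 h3

theorem isBaseSystem_odd (hh : 1 ≤ h) :
    IsBaseSystem (4 * h + 3) (2 * h + 1) ![oddX₀ h, oddX₁ h, oddX₂ h]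
      ![alternating 1 0, switching (2 * h + 1) 1 0, switching (2 * h + 1) 0 1]
      ![oddY₀ h, oddY₁ h] ![alternating 0 1, alternating 1 0] (h + 1) where
  matched j := by
    fin_cases j
    exacts [⟨_, isMatchedSeq_odd₀⟩, ⟨_, isMatchedSeq_odd₁⟩, ⟨_, isMatchedSeq_odd₂⟩]
  antipodal j := by
    fin_cases j
    exacts [isAntipodalTransversal_odd₀, isAntipodalTransversal_odd₁]
  step := ⟨4, 1, by push_cast; ring⟩
  first p := by
    obtain rfl | rfl : p = 0 ∨ p = 1 := by omega
    exacts [⟨0, rfl⟩, ⟨1, rfl⟩]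
  last p := by
    obtain rfl | rfl : p = 0 ∨ p = 1 := by omega
    · exact ⟨0, by simp [alternating]⟩
    · exact ⟨1, by simp [alternating]⟩
  pure_zero d h1 h2 := by
    push_cast at h2
    exact ⟨hasDiff_oddBase_zero_zero hh h1 h2, hasDiff_oddBase_zero_zero_sub hh h1 h2⟩
  pure_one d h1 h2 := by
    push_cast at h2
    exact ⟨hasDiff_oddBase_one_one hh h1 h2, hasDiff_oddBase_one_one_sub hh h1 h2⟩
  mixed d h1 h2 := by
    push_cast at h1 h2
    exact ⟨hasDiff_oddBase_zero_one hh h1 h2, hasDiff_oddBase_zero_one_add hh h1 h2⟩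

end Odd

end EquitableCycles

theorem mainTheorem4 (ℓ : ℕ) (hodd : Odd ℓ) (hℓ : 7 ≤ ℓ) :
    ∃ (𝒞 : Set (SimpleGraph.completeGraph (EquitableCycles.Vertex (2 * ℓ))).Subgraph)
      (B : Fin 6 → (SimpleGraph.completeGraph (EquitableCycles.Vertex (2 * ℓ))).Subgraph),
      -- the vertex set has `4ℓ + 1` elements, and `𝒞` is an `ℓ`-cycle decomposition
      Nat.card (EquitableCycles.Vertex (2 * ℓ)) = 4 * ℓ + 1 ∧
      EquitableCycles.IsCycleDecomposition
        (SimpleGraph.completeGraph (EquitableCycles.Vertex (2 * ℓ))) ℓ 𝒞 ∧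
      -- the colouring is equitable, with colour classes of sizes `2ℓ` and `2ℓ + 1`
      EquitableCycles.IsEquitableColouring ℓ 𝒞 (EquitableCycles.colouring ℓ) ∧
      {v | EquitableCycles.colouring ℓ v = EquitableCycles.Colour.red}.ncard = 2 * ℓ ∧
      {v | EquitableCycles.colouring ℓ v = EquitableCycles.Colour.blue}.ncard = 2 * ℓ + 1 ∧
      -- the decomposition is `2`-rotational
      EquitableCycles.IsTwoRotational (2 * ℓ) 𝒞 ∧
      -- it is developed modulo `2ℓ` from six base cycles, with the stated orbit lengths
      (𝒞 = ⋃ i : Fin 6, EquitableCycles.development (B i)) ∧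
      (∀ i : Fin 6, (EquitableCycles.development (B i)).ncard =
        ![2 * ℓ, 2 * ℓ, 2 * ℓ, ℓ, ℓ, 2] i) ∧
      (∀ i : Fin 6, none ∈ (B i).verts ↔ i = 3 ∨ i = 4) := by
  obtain ⟨h, rfl | rfl⟩ : ∃ h, ℓ = 4 * h + 1 ∨ ℓ = 4 * h + 3 := by
    obtain ⟨k, rfl⟩ := hodd
    exact ⟨k / 2, by omega⟩
  · exact (EquitableCycles.isBaseSystem_even (by omega)).exists_decomposition (by ring) (by omega)
  · exact (EquitableCycles.isBaseSystem_odd (by omega)).exists_decomposition (by ring) (by omega)
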